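/- Let $\Sigma$ be an alphabet with a letter $\$\in\Sigma$. A string terminates with the unique end-marker $\$$ if its last letter is $\$$ and $\$$ occurs nowhere else in it. For such a string $T$: - A substring $x$ of $T$ is *right-maximal* if $xa$ and $xb$ are substrings of $T$ for two distinct letters $a,b$, or $x$ is a suffix of $T$; it is *left-maximal* if $ax$ and $bx$ are substrings of $T$ for two distinct letters $a,b$, or $x$ is a prefix of $T$; it is *maximal* if it is both. - The suffix tree of $T$ has the right-maximal substrings as nodes, and an edge labeled $\beta\neq\varepsilon$ from $u$ to $u\beta$ whenever $u$ and $u\beta$ are nodes and no node lies strictly between them, i.e. $u\gamma$ is not a node for any non-empty proper prefix $\gamma$ of $\beta$. The compact directed acyclic word graph $\mathrm{CDAWG}(T)$ is the edge-labeled directed acyclic graph obtained from the suffix tree by merging isomorphic subtrees. Each of its nodes is identified with the longest string it represents; the nodes are then exactly the maximal substrings of $T$, the source is $\varepsilon$ and the sink is $T$. Let $e(T)$ be the number of edges of $\mathrm{CDAWG}(T)$. - The *CDAWG-grammar* of $T$ is obtained as follows. Take a nonterminal $F_v$ for every non-source node $v$ of $\mathrm{CDAWG}(T)$, with start symbol $F_T$.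 The rule of $F_v$ has on its right-hand side one symbol for each edge $(x,\beta,v)$ entering $v$, in the order of decreasing $|x|+|\beta|$: the first letter of $\beta$ if $x=\varepsilon$, and $F_x$ otherwise. Then every rule with a single symbol on its right-hand side is removed, its left-hand side being replaced by that symbol in all other rules. Let $g(T)$ be the size of the resulting grammar, i.e. the total length of the right-hand sides of its rules. (For $T=\$$ no rule is left and $g(T)=0$.) **Theorem.** Let $T$ and $T'$ be strings over $\Sigma$ that both terminate with the unique end-marker $\$$, and let $T'$ be obtained from $T$ by the insertion, deletion or substitution of a single character. Then $$g(T')-g(T)\le 4\,e(T)+4 .$$ -/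

import Mathlib

namespace CDAWG

variable {α : Type*}

/-- `T` terminates with the unique end-marker `d`. -/
def EndsUniquely (d : α) (T : List α) : Prop :=
  ∃ u : List α, d ∉ u ∧ T = u ++ [d]

/-- `T'` arises from `T` by inserting, deleting or substituting one character. -/
inductive SingleEdit : List α → List α → Prop
  | insertion (p s : List α) (a : α) : SingleEdit (p ++ s) (p ++ a :: s)
  | deletion (p s : List α) (a : α) : SingleEdit (p ++ a :: s) (p ++ s)
  | substitution (p s : List α) (a b : α) (hab : a ≠ b) :
      SingleEdit (p ++ a :: s) (p ++ b :: s)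

def LeftMaximal (T x : List α) : Prop :=
  x <:+: T ∧ ((∃ a b : α, a ≠ b ∧ (a :: x) <:+: T ∧ (b :: x) <:+: T) ∨ x <+: T)

def RightMaximal (T x : List α) : Prop :=
  x <:+: T ∧ ((∃ a b : α, a ≠ b ∧ (x ++ [a]) <:+: T ∧ (x ++ [b]) <:+: T) ∨ x <:+ T)

def MaximalSubstring (T x : List α) : Prop :=
  LeftMaximal T x ∧ RightMaximal T x

/-- The nodes of the suffix tree of `T` are the right-maximal substrings of `T`;
`SuffixTreeEdge T u β` says that it has an edge labeled `β` from `u` to its child `u ++ β`. -/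
def SuffixTreeEdge (T u β : List α) : Prop :=
  RightMaximal T u ∧ β ≠ [] ∧ RightMaximal T (u ++ β) ∧
    ∀ γ : List α, γ <+: β → γ ≠ [] → RightMaximal T (u ++ γ) → γ = β

/-- The subtrees of the suffix tree of `T` rooted at the nodes `u` and `v` are isomorphic as
edge-labeled trees: the same label sequences lead from `u` and from `v` to descendants. -/
def SubtreeIso (T u v : List α) : Prop :=
  ∀ w : List α, RightMaximal T (u ++ w) ↔ RightMaximal T (v ++ w)

/-- The nodes of the CDAWG of `T`, i.e. the classes of suffix tree nodes with isomorphic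
subtrees, each class being represented by its longest member, a maximal substring of `T`.
The source is `[]` and the sink is `T`. -/
def nodes (T : List α) : Set (List α) :=
  {x | MaximalSubstring T x}

/-- The labeled edges of the CDAWG of `T`: a triple `(x, β, y)` is an edge with label `β` from
node `x` to node `y`, where `y` represents the class of the child `x ++ β` of `x`. -/
def edges (T : List α) : Set (List α × List α × List α) :=
  {e | e.1 ∈ nodes T ∧ e.2.2 ∈ nodes T ∧
    SuffixTreeEdge T e.1 e.2.1 ∧ SubtreeIso T (e.1 ++ e.2.1) e.2.2}

/-- The number of edges of the CDAWG of `T`. -/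
noncomputable def size (T : List α) : ℕ :=
  (edges T).ncard

theorem finite_infix (T : List α) : {x : List α | x <:+: T}.Finite :=
  (List.finite_toSet T.sublists).subset fun _ hx => List.mem_sublists.2 hx.sublist

theorem nodes_finite (T : List α) : (nodes T).Finite :=
  (finite_infix T).subset fun _ hx => hx.1.1

theorem edges_finite (T : List α) : (edges T).Finite :=
  ((finite_infix T).prod ((finite_infix T).prod (finite_infix T))).subset fun _ he =>
    ⟨he.1.1.1, (List.infix_append' _ _ []).trans (by simpa using he.2.2.1.2.2.1.1), he.2.1.1.1⟩

/-- The edges of the CDAWG of `T` that enter the node `v`. -/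
noncomputable def inEdges (T v : List α) : Finset (List α × List α × List α) :=
  ((edges_finite T).subset (Set.sep_subset (edges T) fun e => e.2.2 = v)).toFinset

/-- The grammar symbol contributed by an edge of the CDAWG: an edge that leaves the source
contributes the first character of its label, an edge that leaves another node `x` contributes
the nonterminal of `x`. -/
def edgeSymbol : List α × List α × List α → Symbol α (List α)
  | ([], a :: _, _) => Symbol.terminal a
  | (x, _, _) => Symbol.nonterminal x

/-- The right-hand side of the rule of the non-source node `v` in the grammar whose derivation
tree is the unfolding of the reversed CDAWG. The edges `(x, β, v)` that enter `v` are taken in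
the order of decreasing `|x| + |β|`, which is the left-to-right order in that tree. -/
noncomputable def rhs (T v : List α) : List (Symbol α (List α)) :=
  ((inEdges T v).toList.mergeSort
    fun e f => f.1.length + f.2.1.length ≤ e.1.length + e.2.1.length).map edgeSymbol

open Classical in
/-- The rules of the grammar read off from the reversed CDAWG of `T`: the nonterminals are the
non-source nodes, each with exactly one rule, and the start symbol is the sink `T`. -/
noncomputable def initialGrammar (T : List α) : Finset (ContextFreeRule α (List α)) :=
  ((nodes_finite T).toFinset.erase []).image fun v => ⟨v, rhs T v⟩

/-- Replace a nonterminal whose rule has a single symbol on the right by that symbol. -/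
noncomputable def contract (T : List α) : Symbol α (List α) → Symbol α (List α)
  | Symbol.terminal a => Symbol.terminal a
  | Symbol.nonterminal v =>
    match rhs T v with
    | [s] => s
    | _ => Symbol.nonterminal v

open Classical in
/-- The CDAWG-grammar of `T`: every redundant rule, i.e. every rule with a single symbol on the
right, is removed, and its left-hand side is replaced by that symbol wherever it occurs. Chains
of redundant rules run through shorter and shorter nodes, so `T.length` replacements suffice. -/
noncomputable def grammar (T : List α) : Finset (ContextFreeRule α (List α)) :=
  ((initialGrammar T).filter fun r => r.output.length ≠ 1).image
    fun r => ⟨r.input, r.output.map ((contract T)^[T.length])⟩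

/-- The size of a grammar: the total length of the right-hand sides of its rules. -/
def grammarSize {N : Type*} (G : Finset (ContextFreeRule α N)) : ℕ :=
  ∑ r ∈ G, r.output.length

/-- The size of the CDAWG-grammar of `T`. -/
noncomputable def gsize (T : List α) : ℕ :=
  grammarSize (grammar T)

end CDAWG

/-! The bound holds for `gsize T'` itself, without subtracting `gsize T`. Edges of the CDAWG
correspond to pairs of a node `x` and a letter following `x`, so the out-degree of `x` is the number
of its right letters. A rule of length `k ≠ 1` satisfies `k ≤ 2 * (k - 1)`, and a rule of length 1
disappears. Hence `g` is at most twice `R = e - n + 1`, where `n` is the number of nodes, and `R` is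
also the sum of out-degree minus one over all nodes but the sink (`gsize_le`). It remains to show
`R(T') ≤ 2 e(T) + 2`.

Write `T = p b s` and `T' = p c s` with `|c| ≤ 1`. What a node `x` of `T'` contributes to `R(T')` is
charged to four accounts. If `x` is a node of `T`, its old right letters cost at most `R(T)` in
total. If `x` is left-maximal in `T`, its new right letters are charged to the start of an
occurrence in `p`, and they cost at most `n` (`sum_newLetters_le`). If `x` occurs in `T` but is not
left-maximal there, its old right letters, and the new ones seen after a new left context, are
charged to prefixes of `s`, at cost at most `R(T)` (`sum_coveredLetters_le`). All other
contributions come from pairs of occurrences of `x` near the edit that differ on both sides. The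
distance of such a pair determines `x`, and it yields a prefix of `s` that is a suffix of `p`; there
are at most `n` of these distances (`sum_pairDistances_le`, `card_borders_le`). The total is `2 R(T)
+ 2 n = 2 e(T) + 2`. -/

namespace CDAWG

variable {α : Type*}

/-! ### Occurrences of factors -/

/-- `x` occurs in `T` at position `i`. -/
def OccAt (T x : List α) (i : ℕ) : Prop :=
  i + x.length ≤ T.length ∧ ∀ k < x.length, T[i + k]? = x[k]?

theorem occAt_append (l x r : List α) : OccAt (l ++ x ++ r) x l.length := by
  refine ⟨by simp, fun k hk => ?_⟩
  rw [List.append_assoc, List.getElem?_append_right (by omega), Nat.add_sub_cancel_left,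
    List.getElem?_append_left hk]

theorem OccAt.eq_append {T x : List α} {i : ℕ} (h : OccAt T x i) :
    T = T.take i ++ x ++ T.drop (i + x.length) := by
  obtain ⟨h1, h2⟩ := h
  have hx : x = (T.drop i).take x.length := by
    apply List.ext_getElem?
    intro k
    by_cases hk : k < x.length
    · rw [List.getElem?_take_of_lt hk, List.getElem?_drop, h2 k hk]
    · rw [List.getElem?_eq_none (by omega), List.getElem?_eq_none (by simp; omega)]
  conv_lhs => rw [← List.take_append_drop i T, ← List.take_append_drop x.length (T.drop i), ← hx,
    List.drop_drop]
  simp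

theorem OccAt.infix {T x : List α} {i : ℕ} (h : OccAt T x i) : x <:+: T :=
  ⟨_, _, h.eq_append.symm⟩

theorem infix_iff_occAt {T x : List α} : x <:+: T ↔ ∃ i, OccAt T x i := by
  constructor
  · rintro ⟨l, r, rfl⟩
    exact ⟨_, occAt_append l x r⟩
  · rintro ⟨i, h⟩
    exact h.infix

theorem prefix_iff_occAt {T x : List α} : x <+: T ↔ OccAt T x 0 := by
  constructor
  · rintro ⟨r, rfl⟩
    exact occAt_append [] x r
  · intro h
    have := h.eq_append
    simp only [List.take_zero, List.nil_append] at this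
    exact ⟨_, this.symm⟩

theorem occAt_concat {T x : List α} {a : α} {i : ℕ} :
    OccAt T (x ++ [a]) i ↔ OccAt T x i ∧ T[i + x.length]? = some a := by
  constructor
  · rintro ⟨h1, h2⟩
    simp only [List.length_append, List.length_cons, List.length_nil, zero_add] at h1 h2
    refine ⟨⟨by omega, fun k hk => ?_⟩, ?_⟩
    · rw [h2 k (by omega), List.getElem?_append_left hk]
    · rw [h2 _ (by omega)]; simp
  · rintro ⟨⟨h1, h2⟩, h3⟩
    obtain ⟨h4, -⟩ := List.getElem?_eq_some_iff.1 h3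
    refine ⟨by simp; omega, fun k hk => ?_⟩
    simp only [List.length_append, List.length_cons, List.length_nil, zero_add] at hk
    by_cases hk' : k < x.length
    · rw [h2 k hk', List.getElem?_append_left hk']
    · obtain rfl : k = x.length := by omega
      rw [h3]; simp

theorem occAt_cons {T x : List α} {a : α} {i : ℕ} :
    OccAt T (a :: x) i ↔ T[i]? = some a ∧ OccAt T x (i + 1) := by
  constructor
  · rintro ⟨h1, h2⟩
    simp only [List.length_cons] at h1 h2
    refine ⟨by simpa using h2 0 (by omega), by omega, fun k hk => ?_⟩
    have := h2 (k + 1) (by omega)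
    rwa [List.getElem?_cons_succ, ← add_assoc, add_right_comm] at this
  · rintro ⟨h0, h1, h2⟩
    refine ⟨by simp; omega, fun k hk => ?_⟩
    cases k with
    | zero => simpa using h0
    | succ k =>
      simp only [List.length_cons] at hk
      rw [List.getElem?_cons_succ, ← h2 k (by omega)]
      congr 1; omega

/-- A shorter string that occurs within an occurrence of `x` is a factor of `x`. -/
theorem OccAt.restrict {T x y : List α} {i j : ℕ} (hx : OccAt T x i) (hy : OccAt T y j)
    (hij : i ≤ j) (hle : j + y.length ≤ i + x.length) : OccAt x y (j - i) := by
  refine ⟨by omega, fun k hk => ?_⟩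
  rw [← hy.2 k hk, ← hx.2 _ (by omega)]
  congr 1; omega

theorem OccAt.trans {T x y : List α} {i j : ℕ} (hx : OccAt T x i) (hy : OccAt x y j) :
    OccAt T y (i + j) := by
  have := hx.1
  have := hy.1
  refine ⟨by omega, fun k hk => ?_⟩
  rw [← hy.2 k hk, ← hx.2 _ (by omega)]
  congr 1; omega

theorem OccAt.eq_of_length_eq {T x y : List α} {i : ℕ} (hx : OccAt T x i) (hy : OccAt T y i)
    (h : x.length = y.length) : x = y := by
  apply List.ext_getElem?
  intro k
  by_cases hk : k < x.length
  · rw [← hx.2 k hk, ← hy.2 k (by omega)]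
  · rw [List.getElem?_eq_none (by omega), List.getElem?_eq_none (by omega)]

theorem suffix_of_occAt {T x : List α} {i : ℕ} (h : OccAt T x i) (hi : i + x.length = T.length) :
    x <:+ T := by
  have := h.eq_append
  rw [List.drop_eq_nil_of_le (by omega), List.append_nil] at this
  exact ⟨_, this.symm⟩

theorem occAt_of_suffix {T x : List α} (h : x <:+ T) : OccAt T x (T.length - x.length) := by
  obtain ⟨l, rfl⟩ := h
  simpa using occAt_append l x []

theorem infix_append_cancel_right {T x w : List α} (h : x ++ w <:+: T) : x <:+: T :=
  (List.prefix_append x w).isInfix.trans h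

theorem infix_append_cancel_left {T x w : List α} (h : w ++ x <:+: T) : x <:+: T :=
  (List.suffix_append w x).isInfix.trans h

/-! ### Left and right closure -/

/-- Every factor of `T` extends to the left to a left-maximal one without losing occurrences. -/
theorem exists_left_closure (T x : List α) (hx : x <:+: T) :
    ∃ y, x <:+ y ∧ LeftMaximal T y ∧ (∀ w, x ++ w <:+: T ↔ y ++ w <:+: T) ∧
      (∀ w, x ++ w <:+ T ↔ y ++ w <:+ T) := by
  induction hn : T.length - x.length using Nat.strong_induction_on generalizing x with
  | _ n ih =>
    by_cases hL : LeftMaximal T x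
    · exact ⟨x, List.suffix_rfl, hL, fun _ => Iff.rfl, fun _ => Iff.rfl⟩
    have hpre : ¬ x <+: T := fun h => hL ⟨hx, Or.inr h⟩
    have key : ∀ l r, T = l ++ (x ++ r) → ∃ l' a, l = l' ++ [a] := by
      intro l r h
      rcases List.eq_nil_or_concat' l with rfl | ⟨l', a, rfl⟩
      · exact absurd ⟨r, by simpa using h.symm⟩ hpre
      · exact ⟨l', a, rfl⟩
    obtain ⟨l, r, hlr⟩ := id hx
    obtain ⟨l', a, rfl⟩ := key l r (by simpa using hlr.symm)
    have hax : a :: x <:+: T := ⟨l', r, by simpa using hlr⟩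
    have huniq : ∀ b, b :: x <:+: T → b = a := by
      intro b hb
      by_contra hne
      exact hL ⟨hx, Or.inl ⟨b, a, hne, hb, hax⟩⟩
    -- The only possible left letter `a` is forced, so prepending it loses no occurrence; the
    -- recursion stops because factors are no longer than `T`.
    have hlen := hax.length_le
    simp only [List.length_cons] at hlen
    obtain ⟨y, hy1, hy2, hy3, hy4⟩ :=
      ih (T.length - (a :: x).length) (by simp only [List.length_cons]; omega) (a :: x) hax rfl
    refine ⟨y, (List.suffix_cons a x).trans hy1, hy2, fun w => ?_, fun w => ?_⟩
    · rw [← hy3]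
      constructor
      · rintro ⟨l, r, h⟩
        obtain ⟨l', b, rfl⟩ := key l (w ++ r) (by simpa using h.symm)
        have := huniq b ⟨l', w ++ r, by simpa using h⟩
        subst this
        exact ⟨l', r, by simpa using h⟩
      · exact fun h => (List.suffix_cons a (x ++ w)).isInfix.trans h
    · rw [← hy4]
      constructor
      · rintro ⟨l, h⟩
        obtain ⟨l', b, rfl⟩ := key l w (by simpa using h.symm)
        have := huniq b ⟨l', w, by simpa using h⟩
        subst this
        exact ⟨l', by simpa using h⟩
      · exact fun h => (List.suffix_cons a (x ++ w)).trans h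

theorem leftMaximal_reverse {T x : List α} :
    LeftMaximal T.reverse x.reverse ↔ RightMaximal T x := by
  have h : ∀ a, a :: x.reverse <:+: T.reverse ↔ x ++ [a] <:+: T := by
    intro a
    rw [← List.reverse_infix (l₁ := x ++ [a])]
    simp
  simp only [LeftMaximal, RightMaximal, h, List.reverse_infix, List.reverse_prefix]

/-- Every factor of `T` extends to the right to a right-maximal one without losing
occurrences. -/
theorem exists_right_closure (T x : List α) (hx : x <:+: T) :
    ∃ y, x <+: y ∧ RightMaximal T y ∧ (∀ w, w ++ x <:+: T ↔ w ++ y <:+: T) ∧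
      (∀ w, w ++ x <+: T ↔ w ++ y <+: T) := by
  obtain ⟨y, h1, h2, h3, h4⟩ := exists_left_closure T.reverse x.reverse (List.reverse_infix.2 hx)
  refine ⟨y.reverse, ?_, ?_, fun w => ?_, fun w => ?_⟩
  · rw [← List.reverse_suffix]; simpa using h1
  · rw [← leftMaximal_reverse]; simpa using h2
  · have := h3 w.reverse
    rw [← List.reverse_infix (l₁ := w ++ x), ← List.reverse_infix (l₁ := w ++ y.reverse)]
    simpa using this
  · have := h4 w.reverse
    rw [← List.reverse_suffix (l₁ := w ++ x), ← List.reverse_suffix (l₁ := w ++ y.reverse)]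
    simpa using this

/-- If `y = x ++ t` with `t` nonempty, any occurring `x ++ w` forces `x ++ t ++ w` to occur.
Iterating produces factors of unbounded length. -/
theorem eq_of_prefix_of_infix_iff {T x y : List α} (hx : x <:+: T) (hxy : x <+: y)
    (h : ∀ w, x ++ w <:+: T ↔ y ++ w <:+: T) : x = y := by
  obtain ⟨t, rfl⟩ := hxy
  by_contra hne
  have ht : 0 < t.length := by
    rcases t with _ | ⟨a, t⟩
    · simp at hne
    · simp
  have key : ∀ n : ℕ, ∃ w, n ≤ w.length ∧ x ++ w <:+: T := by
    intro n
    induction n with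
    | zero => exact ⟨[], by simp, by simpa using hx⟩
    | succ n ih =>
      obtain ⟨w, hw, hxw⟩ := ih
      refine ⟨t ++ w, by simp; omega, ?_⟩
      rw [← List.append_assoc]
      exact (h w).1 hxw
  obtain ⟨w, hw, hxw⟩ := key (T.length + 1)
  have := hxw.length_le
  simp at this
  omega

theorem eq_of_suffix_of_infix_iff {T x y : List α} (hx : x <:+: T) (hxy : x <:+ y)
    (h : ∀ w, w ++ x <:+: T ↔ w ++ y <:+: T) : x = y := by
  apply List.reverse_injective
  refine eq_of_prefix_of_infix_iff (T := T.reverse) (List.reverse_infix.2 hx)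
    (List.reverse_prefix.2 hxy) fun w => ?_
  have := h w.reverse
  rw [← List.reverse_infix, ← List.reverse_infix (l₁ := w.reverse ++ y)] at this
  simpa using this

/-! ### Right letters and the end-marker -/

theorem finite_rightLetters (T x : List α) : {a | x ++ [a] <:+: T}.Finite :=
  (List.finite_toSet T).subset fun a ha =>
    ((infix_append_cancel_left ha).subset : [a] ⊆ T) (by simp)

/-- The letters that follow an occurrence of `x` in `T`. -/
noncomputable def rightLetters (T x : List α) : Finset α := (finite_rightLetters T x).toFinset

@[simp] theorem mem_rightLetters {T x : List α} {a : α} :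
    a ∈ rightLetters T x ↔ x ++ [a] <:+: T := by
  simp [rightLetters]

/-- The nodes of the CDAWG of `T` as a finset. -/
noncomputable def nodeFinset (T : List α) : Finset (List α) := (nodes_finite T).toFinset

@[simp] theorem mem_nodeFinset {T x : List α} : x ∈ nodeFinset T ↔ MaximalSubstring T x := by
  simp [nodeFinset, nodes]

theorem rightLetters_self (T : List α) : rightLetters T T = ∅ := by
  ext a
  simp only [mem_rightLetters, Finset.notMem_empty, iff_false]
  intro h
  have := h.length_le
  simp at this

theorem self_mem_nodeFinset (T : List α) : T ∈ nodeFinset T := by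
  rw [mem_nodeFinset]
  exact ⟨⟨List.infix_rfl, Or.inr List.prefix_rfl⟩, ⟨List.infix_rfl, Or.inr List.suffix_rfl⟩⟩

namespace EndsUniquely

variable {d : α} {T : List α}

theorem ne_nil (hT : EndsUniquely d T) : T ≠ [] := by
  obtain ⟨u, -, rfl⟩ := hT; simp

theorem mem (hT : EndsUniquely d T) : d ∈ T := by
  obtain ⟨u, -, rfl⟩ := hT; simp

theorem eq_nil_of_append (hT : EndsUniquely d T) {l r : List α} (h : T = l ++ r) (hd : d ∈ l) :
    r = [] := by
  obtain ⟨u, hu, rfl⟩ := hT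
  rcases List.eq_nil_or_concat' r with rfl | ⟨r', a, rfl⟩
  · rfl
  · rw [← List.append_assoc] at h
    have := List.append_inj_left' h rfl
    subst this
    simp [hd] at hu

theorem suffix_of_infix (hT : EndsUniquely d T) {x : List α} (hx : x <:+: T) (hd : d ∈ x) :
    x <:+ T := by
  obtain ⟨l, r, h⟩ := hx
  obtain rfl := hT.eq_nil_of_append h.symm (by simp [hd])
  exact ⟨l, by simpa using h⟩

theorem mem_of_suffix (hT : EndsUniquely d T) {x : List α} (hx : x <:+ T) (hne : x ≠ []) :
    d ∈ x := by
  obtain ⟨u, hu, rfl⟩ := hT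
  obtain ⟨l, h⟩ := hx
  rcases List.eq_nil_or_concat' x with rfl | ⟨x', a, rfl⟩
  · exact absurd rfl hne
  · rw [← List.append_assoc] at h
    have := List.append_inj_right' h rfl
    simp_all

/-- A left-maximal factor that contains the end-marker is the whole string. -/
theorem eq_of_leftMaximal (hT : EndsUniquely d T) {x : List α} (hx : LeftMaximal T x)
    (hd : d ∈ x) : x = T := by
  obtain ⟨h1, ⟨a, b, hab, ha, hb⟩ | h2⟩ := hx
  · have ha' := hT.suffix_of_infix ha (by simp [hd])
    have hb' := hT.suffix_of_infix hb (by simp [hd])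
    exact absurd (List.cons.inj ((List.suffix_of_suffix_length_le ha' hb' (by simp)).eq_of_length
      (by simp))).1 hab
  · obtain ⟨r, hr⟩ := h2
    obtain rfl := hT.eq_nil_of_append hr.symm hd
    simpa using hr

theorem rightLetters_nonempty (hT : EndsUniquely d T) {x : List α} (hx : x <:+: T) (hd : d ∉ x) :
    (rightLetters T x).Nonempty := by
  rcases eq_or_ne x [] with rfl | hne
  · obtain ⟨a, t, rfl⟩ := List.exists_cons_of_ne_nil hT.ne_nil
    exact ⟨a, mem_rightLetters.2 ⟨[], t, rfl⟩⟩
  obtain ⟨l, r, h⟩ := hx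
  rcases r with _ | ⟨a, r⟩
  · exact absurd (hT.mem_of_suffix ⟨l, by simpa using h⟩ hne) hd
  · exact ⟨a, mem_rightLetters.2 ⟨l, r, by simpa using h⟩⟩

end EndsUniquely

/-! ### Nodes and edges of the CDAWG in terms of right letters -/

theorem rightMaximal_of_suffix {T x : List α} (h : x <:+ T) : RightMaximal T x :=
  ⟨h.isInfix, Or.inr h⟩

theorem SubtreeIso.infix_iff {T x y : List α} (h : SubtreeIso T x y) (w : List α) :
    x ++ w <:+: T ↔ y ++ w <:+: T := by
  have key : ∀ {x y : List α}, SubtreeIso T x y → x ++ w <:+: T → y ++ w <:+: T := by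
    rintro x y h ⟨l, r, hlr⟩
    have h1 : RightMaximal T (x ++ (w ++ r)) :=
      rightMaximal_of_suffix ⟨l, by simpa using hlr⟩
    have h2 := ((h _).1 h1).1
    rw [← List.append_assoc] at h2
    exact infix_append_cancel_right h2
  exact ⟨key h, key fun w => (h w).symm⟩

/-- Nodes of the CDAWG that have the same right contexts coincide. -/
theorem eq_of_infix_iff {d : α} {T x y : List α} (hT : EndsUniquely d T)
    (hx : LeftMaximal T x) (hy : LeftMaximal T y)
    (h : ∀ w, x ++ w <:+: T ↔ y ++ w <:+: T) : x = y := by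
  have main : ∀ {x y : List α}, LeftMaximal T x → x <:+ y → x ≠ [] →
      (∀ w, x ++ w <:+: T ↔ y ++ w <:+: T) → x = y := by
    rintro x y hx ⟨t, rfl⟩ hne h
    rcases List.eq_nil_or_concat' t with rfl | ⟨t, e, rfl⟩
    · rfl
    exfalso
    -- Extend an occurrence of `a :: x` to the end of `T`. The same extension of `y` contains the
    -- end-marker, so it is a suffix of `T` too, and comparing the two suffixes gives `a = e`.
    have key : ∀ a, a :: x <:+: T → a = e := by
      rintro a ⟨l, r, hlr⟩
      have h1 : a :: (x ++ r) <:+ T := ⟨l, by simpa using hlr⟩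
      have h2 : x ++ r <:+ T := (List.suffix_cons a (x ++ r)).trans h1
      have hd := hT.mem_of_suffix h2 (by simp [hne])
      have h3 := (h r).1 h2.isInfix
      have h4 := hT.suffix_of_infix h3 (by simp_all)
      have h5 : e :: (x ++ r) <:+ T :=
        List.IsSuffix.trans ⟨t, by simp⟩ h4
      exact (List.cons.inj ((List.suffix_of_suffix_length_le h1 h5 (by simp)).eq_of_length
        (by simp))).1
    obtain ⟨-, ⟨a, b, hab, ha, hb⟩ | ⟨r, hr⟩⟩ := hx
    · exact hab ((key a ha).trans (key b hb).symm)
    · have h1 := ((h r).1 (by rw [hr])).length_le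
      rw [← hr] at h1
      simp at h1
      omega
  have nil : ∀ {y : List α}, (∀ w, [] ++ w <:+: T ↔ y ++ w <:+: T) → [] = y := by
    intro y h
    have h1 := ((h T).1 (by simp)).length_le
    simp at h1
    exact h1.symm
  rcases eq_or_ne x [] with rfl | hx0
  · exact nil h
  rcases eq_or_ne y [] with rfl | hy0
  · exact (nil fun w => (h w).symm).symm
  -- Two suffixes of `T` are comparable, so a common `w` makes one of `x`, `y` a suffix of the
  -- other, which reduces the claim to `main`.
  have hcmp : ∃ w, x ++ w <:+ T ∧ y ++ w <:+ T := by
    obtain ⟨l, r, hlr⟩ := hx.1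
    have h1 : x ++ r <:+ T := ⟨l, by simpa using hlr⟩
    rcases eq_or_ne r [] with rfl | hr
    · refine ⟨[], h1, ?_⟩
      obtain ⟨l', r', hlr'⟩ := hy.1
      have h2 : y ++ r' <:+ T := ⟨l', by simpa using hlr'⟩
      obtain ⟨l'', r'', h3⟩ := (h r').2 h2.isInfix
      have hd := hT.mem_of_suffix h1 (by simp [hx0])
      have := hT.eq_nil_of_append (l := l'' ++ x) (r := r' ++ r'') (by simpa using h3.symm)
        (by simp_all)
      simp only [List.append_eq_nil_iff] at this
      rw [this.1] at h2
      exact h2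
    · have hd := hT.mem_of_suffix (x := r) ⟨l ++ x, hlr⟩ hr
      exact ⟨r, h1, hT.suffix_of_infix ((h r).1 h1.isInfix) (by simp [hd])⟩
  obtain ⟨w, hw1, hw2⟩ := hcmp
  rcases le_total x.length y.length with hle | hle
  · have := List.suffix_of_suffix_length_le hw1 hw2 (by simpa using hle)
    exact main hx (List.suffix_append_self_iff.1 this) hx0 h
  · have := List.suffix_of_suffix_length_le hw2 hw1 (by simpa using hle)
    exact (main hy (List.suffix_append_self_iff.1 this) hy0
      fun w => (h w).symm).symm

theorem prefix_or_branch : ∀ x y : List α,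
    x <+: y ∨ y <+: x ∨ ∃ z a b, a ≠ b ∧ z ++ [a] <+: x ∧ z ++ [b] <+: y
  | [], y => Or.inl (List.nil_prefix)
  | x, [] => Or.inr (Or.inl (List.nil_prefix))
  | a :: x, b :: y => by
    by_cases hab : a = b
    · subst hab
      rcases prefix_or_branch x y with h | h | ⟨z, b, c, hbc, h1, h2⟩
      · exact Or.inl (by simpa using h)
      · exact Or.inr (Or.inl (by simpa using h))
      · exact Or.inr (Or.inr ⟨a :: z, b, c, hbc, by simpa using h1, by simpa using h2⟩)
    · exact Or.inr (Or.inr ⟨[], a, b, hab, by simp, by simp⟩)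

/-- Two labels with the same first letter either are comparable or diverge at a branching factor,
which would be a node strictly inside both edges. -/
theorem SuffixTreeEdge.label_unique {T u β β' : List α} {a : α}
    (h : SuffixTreeEdge T u (a :: β)) (h' : SuffixTreeEdge T u (a :: β')) : β = β' := by
  rcases prefix_or_branch β β' with hp | hp | ⟨z, b, c, hbc, h1, h2⟩
  · have := h'.2.2.2 (a :: β) (by simpa using hp) (by simp) h.2.2.1
    simpa using this
  · have := h.2.2.2 (a :: β') (by simpa using hp) (by simp) h'.2.2.1
    simpa using this.symm
  · exfalso
    have inf : ∀ {β : List α} {b : α}, z ++ [b] <+: β → RightMaximal T (u ++ a :: β) →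
        (u ++ a :: z) ++ [b] <:+: T := by
      rintro β b ⟨t, rfl⟩ h
      have h2 := h.1
      have : u ++ a :: (z ++ [b] ++ t) = (u ++ a :: z ++ [b]) ++ t := by simp
      rw [this] at h2
      exact infix_append_cancel_right h2
    have hb := inf h1 h.2.2.1
    have hc := inf h2 h'.2.2.1
    have hR : RightMaximal T (u ++ a :: z) :=
      ⟨infix_append_cancel_right hb, Or.inl ⟨b, c, hbc, hb, hc⟩⟩
    have hz : z <+: β := (List.prefix_append z [b]).trans h1
    have := h.2.2.2 (a :: z) (by simpa using hz) (by simp) hR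
    simp only [List.cons.injEq, true_and] at this
    subst this
    have := h1.length_le
    simp at this

/-- The shortest right-maximal extension of `x ++ [a]` is the child; its left closure has the same
right contexts and so represents its class. -/
theorem exists_edge {T x : List α} {a : α} (hx : MaximalSubstring T x) (ha : x ++ [a] <:+: T) :
    ∃ β y, (x, a :: β, y) ∈ edges T := by
  classical
  have hex : ∃ n : ℕ, ∃ β : List α, β.length = n ∧ RightMaximal T (x ++ a :: β) := by
    obtain ⟨l, r, h⟩ := ha
    exact ⟨_, r, rfl, rightMaximal_of_suffix ⟨l, by simpa using h⟩⟩
  obtain ⟨β, hβ, hR⟩ := Nat.find_spec hex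
  obtain ⟨y, hy1, hy2, hy3, hy4⟩ := exists_left_closure T (x ++ a :: β) hR.1
  have hiso : SubtreeIso T (x ++ a :: β) y := by
    intro w
    simp only [RightMaximal, List.append_assoc _ w, hy3, hy4]
  refine ⟨β, y, hx, ⟨hy2, ?_⟩, ⟨hx.2, by simp, hR, fun γ hγ hne hRγ => ?_⟩, hiso⟩
  · have := (hiso []).1 (by simpa using hR)
    simpa using this
  · rcases γ with _ | ⟨b, γ⟩
    · exact absurd rfl hne
    · obtain ⟨rfl, hpre⟩ := List.cons_prefix_cons.1 hγ
      have := Nat.find_min' hex ⟨γ, rfl, hRγ⟩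
      rw [hpre.eq_of_length_le (hβ.trans_le this)]

theorem sum_card_rightLetters_le_size (T : List α) :
    ∑ x ∈ nodeFinset T, (rightLetters T x).card ≤ size T := by
  classical
  rw [← Finset.card_sigma, size, Set.ncard_eq_toFinset_card _ (edges_finite T)]
  have h : ∀ q ∈ (nodeFinset T).sigma fun x => rightLetters T x,
      ∃ e ∈ (edges_finite T).toFinset, e.1 = q.1 ∧ e.2.1.head? = some q.2 := by
    rintro ⟨x, a⟩ hq
    simp only [Finset.mem_sigma, mem_nodeFinset, mem_rightLetters] at hq
    obtain ⟨β, y, he⟩ := exists_edge hq.1 hq.2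
    exact ⟨_, by simpa using he, rfl, rfl⟩
  choose! f hf hf1 hf2 using h
  refine Finset.card_le_card_of_injOn f hf ?_
  rintro ⟨x, a⟩ hq ⟨x', a'⟩ hq' heq
  obtain rfl : x = x' := (hf1 _ hq).symm.trans ((congrArg Prod.fst heq).trans (hf1 _ hq'))
  have := hf2 _ hq
  rw [heq, hf2 _ hq'] at this
  simp only [Option.some.injEq] at this
  subst this
  rfl

/-- An edge is recovered from its source and the first letter of its label: the label by
`label_unique`, the target because nodes with equal right contexts coincide. -/
theorem size_le_sum_card_rightLetters {d : α} {T : List α} (hT : EndsUniquely d T) :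
    size T ≤ ∑ x ∈ nodeFinset T, (rightLetters T x).card := by
  classical
  rw [← Finset.card_sigma, size, Set.ncard_eq_toFinset_card _ (edges_finite T)]
  have h : ∀ e ∈ (edges_finite T).toFinset,
      ∃ q ∈ (nodeFinset T).sigma fun x => rightLetters T x,
        e.1 = q.1 ∧ e.2.1.head? = some q.2 := by
    rintro ⟨x, β, y⟩ he
    rw [Set.Finite.mem_toFinset] at he
    obtain ⟨h1, -, h2, -⟩ := he
    rcases β with _ | ⟨a, β⟩
    · exact absurd rfl h2.2.1
    · refine ⟨⟨x, a⟩, ?_, rfl, rfl⟩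
      simp only [Finset.mem_sigma, mem_nodeFinset, mem_rightLetters]
      refine ⟨h1, infix_append_cancel_right (w := β) ?_⟩
      simpa using h2.2.2.1.1
  have : Nonempty ((_ : List α) × α) := ⟨⟨[], d⟩⟩
  choose! f hf hf1 hf2 using h
  refine Finset.card_le_card_of_injOn f hf ?_
  rintro ⟨x, β, y⟩ hq ⟨x', β', y'⟩ hq' heq
  have hx : x = x' := by
    have h1 := hf1 _ hq
    have h2 := hf1 _ hq'
    rw [← heq] at h2
    exact h1.trans h2.symm
  subst hx
  have h1 := hf2 _ hq
  have h2 := hf2 _ hq'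
  rw [← heq] at h2
  simp only [Finset.mem_coe, Set.Finite.mem_toFinset] at hq hq'
  rcases β with _ | ⟨a, β⟩
  · simp at h1
  rcases β' with _ | ⟨a', β'⟩
  · simp at h2
  simp only [List.head?_cons, Option.some.injEq] at h1 h2
  obtain rfl : a = a' := h1.trans h2.symm
  obtain rfl := hq.2.2.1.label_unique hq'.2.2.1
  have hy := eq_of_infix_iff hT hq.2.1.1 hq'.2.1.1 fun w =>
    (hq.2.2.2.infix_iff w).symm.trans (hq'.2.2.2.infix_iff w)
  simp only at hy
  rw [hy]

/-! ### In-degrees and the size of the grammar -/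

/-- The longest proper right-maximal prefix of `v` is the source of such an edge: as a prefix of a
left-maximal string it is left-maximal. -/
theorem inEdges_nonempty {T v : List α} (hv : MaximalSubstring T v) (hne : v ≠ []) :
    (inEdges T v).Nonempty := by
  classical
  have hex : ∃ n : ℕ, ∃ x β : List α, β.length = n ∧ β ≠ [] ∧ x ++ β = v ∧ RightMaximal T x :=
    ⟨_, [], v, rfl, hne, rfl, rightMaximal_of_suffix List.nil_suffix⟩
  obtain ⟨x, β, hβ, hβ0, hv', hR⟩ := Nat.find_spec hex
  refine ⟨(x, β, v), ?_⟩
  have hnode : LeftMaximal T x := by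
    subst hv'
    obtain ⟨h1, ⟨a, b, hab, ha, hb⟩ | h2⟩ := hv.1
    · exact ⟨hR.1, Or.inl ⟨a, b, hab, infix_append_cancel_right (w := β) (by simpa using ha),
        infix_append_cancel_right (w := β) (by simpa using hb)⟩⟩
    · exact ⟨hR.1, Or.inr ((List.prefix_append x β).trans h2)⟩
  simp only [inEdges, Set.Finite.mem_toFinset, Set.mem_ofPred_eq, and_true]
  refine ⟨⟨hnode, hR⟩, hv, ⟨hR, hβ0, by simpa [hv'] using hv.2, ?_⟩, fun w => by simp [hv']⟩
  rintro γ ⟨δ, hδ⟩ hγ0 hRγ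
  by_contra hne'
  have hδ0 : δ ≠ [] := by
    rintro rfl
    exact hne' (by simpa using hδ)
  have := Nat.find_min' hex ⟨x ++ γ, δ, rfl, hδ0, by simp [hδ, hv'], hRγ⟩
  have h2 : γ.length + δ.length = β.length := by simpa using congrArg List.length hδ
  have := List.length_pos_iff.2 hγ0
  omega

theorem length_rhs (T v : List α) : (rhs T v).length = (inEdges T v).card := by
  simp [rhs]

-- Contraction replaces symbols by single symbols, so surviving rules keep their length and only the
-- in-degree matters.
open Classical in
theorem gsize_eq (T : List α) :
    gsize T = ∑ v ∈ ((nodeFinset T).erase []).filter fun v => (inEdges T v).card ≠ 1,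
      (inEdges T v).card := by
  have hin : initialGrammar T = ((nodeFinset T).erase []).image fun v => ⟨v, rhs T v⟩ := by
    simp only [initialGrammar, nodeFinset]
  rw [gsize, grammarSize, grammar, Finset.sum_image, hin, Finset.filter_image, Finset.sum_image]
  · refine Finset.sum_congr ?_ fun v _ => ?_
    · ext v; simp [length_rhs]
    · simp [length_rhs]
  · intro v _ w _ h
    exact (ContextFreeRule.mk.inj h).1
  · intro r hr r' hr' h
    simp only [hin, Finset.coe_filter, Finset.mem_image, Set.mem_ofPred_eq] at hr hr'
    obtain ⟨⟨v, -, rfl⟩, -⟩ := hr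
    obtain ⟨⟨w, -, rfl⟩, -⟩ := hr'
    obtain rfl : v = w := (ContextFreeRule.mk.inj h).1
    rfl

theorem sum_card_inEdges_le_size (T : List α) (S : Finset (List α)) :
    ∑ v ∈ S, (inEdges T v).card ≤ size T := by
  classical
  rw [size, Set.ncard_eq_toFinset_card _ (edges_finite T), ← Finset.card_biUnion]
  · refine Finset.card_le_card fun e he => ?_
    simp only [Finset.mem_biUnion, inEdges, Set.Finite.mem_toFinset] at he ⊢
    obtain ⟨v, -, he, -⟩ := he
    exact he
  · intro v _ w _ hvw
    rw [Function.onFun, Finset.disjoint_left]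
    intro e he he'
    simp only [inEdges, Set.Finite.mem_toFinset, Set.mem_ofPred_eq] at he he'
    exact hvw (he.2.symm.trans he'.2)

open Classical in
theorem notMem_of_mem_erase {d : α} {T x : List α} (hT : EndsUniquely d T)
    (hx : x ∈ (nodeFinset T).erase T) : d ∉ x := by
  rw [Finset.mem_erase, mem_nodeFinset] at hx
  exact fun hd => hx.1 (hT.eq_of_leftMaximal hx.2.1 hd)

-- Every node but the sink has a right letter, so the truncated subtraction is exact; the sink has
-- none and accounts for the `+ 1`.
open Classical in
theorem sum_pred_add_card {d : α} {T : List α} (hT : EndsUniquely d T) :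
    ∑ x ∈ (nodeFinset T).erase T, ((rightLetters T x).card - 1) + (nodeFinset T).card =
      ∑ x ∈ nodeFinset T, (rightLetters T x).card + 1 := by
  have hmem := self_mem_nodeFinset T
  rw [← Finset.card_erase_add_one hmem, ← Finset.add_sum_erase _ _ hmem, rightLetters_self,
    Finset.card_empty, zero_add, ← add_assoc, Finset.card_eq_sum_ones, ← Finset.sum_add_distrib]
  congr 1
  refine Finset.sum_congr rfl fun x hx => ?_
  have hd := notMem_of_mem_erase hT hx
  rw [Finset.mem_erase, mem_nodeFinset] at hx
  have := (hT.rightLetters_nonempty hx.2.1.1 hd).card_pos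
  omega

theorem nil_mem_nodeFinset (T : List α) : [] ∈ nodeFinset T :=
  mem_nodeFinset.2 ⟨⟨List.nil_infix, Or.inr List.nil_prefix⟩,
    rightMaximal_of_suffix List.nil_suffix⟩

open Classical in
theorem gsize_le {d : α} {T : List α} (hT : EndsUniquely d T) :
    gsize T ≤ 2 * ∑ x ∈ (nodeFinset T).erase T, ((rightLetters T x).card - 1) := by
  have hpos : ∀ v ∈ (nodeFinset T).erase [], 1 ≤ (inEdges T v).card := by
    intro v hv
    rw [Finset.mem_erase, mem_nodeFinset] at hv
    exact (inEdges_nonempty hv.2 hv.1).card_pos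
  -- Termwise, `k + 2 ≤ 2 * k` for an in-degree `k ≥ 2`, while in-degree 1 contributes nothing to
  -- `gsize`.
  have h1 : gsize T + 2 * ((nodeFinset T).erase []).card ≤
      2 * ∑ v ∈ (nodeFinset T).erase [], (inEdges T v).card := by
    rw [gsize_eq, Finset.sum_filter, Finset.card_eq_sum_ones, Finset.mul_sum, Finset.mul_sum,
      ← Finset.sum_add_distrib]
    refine Finset.sum_le_sum fun v hv => ?_
    have := hpos v hv
    split_ifs <;> omega
  have h2 := sum_card_inEdges_le_size T ((nodeFinset T).erase [])
  have h3 := size_le_sum_card_rightLetters hT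
  have h4 := sum_pred_add_card hT
  have h5 := Finset.card_erase_add_one (nil_mem_nodeFinset T)
  omega

/-! ### Occurrences that meet the edited position -/

/-- The letter of `T` before position `i`, or `none` at the beginning. -/
def leftLetter (T : List α) (i : ℕ) : Option α := if i = 0 then none else T[i - 1]?

/-- The left context `o` of `x` occurs in `T`; `none` stands for the beginning of `T`. -/
def LeftExt (T x : List α) : Option α → Prop
  | none => x <+: T
  | some a => a :: x <:+: T

theorem OccAt.of_left {p c s x : List α} {i : ℕ} (h : OccAt (p ++ c ++ s) x i)
    (hi : i + x.length ≤ p.length) : OccAt p x i := by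
  have hp : OccAt (p ++ c ++ s) p 0 := by simpa using occAt_append [] p (c ++ s)
  simpa using hp.restrict h (Nat.zero_le _) (by omega)

theorem occAt_right (p c s : List α) : OccAt (p ++ c ++ s) s (p.length + c.length) := by
  simpa using occAt_append (p ++ c) s []

theorem OccAt.of_right {p c s x : List α} {i : ℕ} (h : OccAt (p ++ c ++ s) x i)
    (hi : p.length + c.length ≤ i) : OccAt s x (i - (p.length + c.length)) := by
  refine (occAt_right p c s).restrict h hi ?_
  have := h.1
  simp at this
  omega

section Edit

variable {p b c s x : List α} {i : ℕ}

/-- An occurrence in `p ++ c ++ s` of a string that does not occur in `p ++ b ++ s` meets the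
edited position. -/
theorem OccAt.crosses (h : OccAt (p ++ c ++ s) x i) (hx : ¬ x <:+: p ++ b ++ s) :
    i < p.length + c.length ∧ p.length < i + x.length := by
  constructor
  · by_contra hi
    exact hx ((h.of_right (by omega)).infix.trans (List.suffix_append _ _).isInfix)
  · by_contra hi
    refine hx ((h.of_left (by omega)).infix.trans ?_)
    rw [List.append_assoc]
    exact (List.prefix_append _ _).isInfix

/-- The extended string `x ++ [a]` must cross the edit, so `x` itself crosses or touches the end of
`p`. A new left context gives the analogous statement at the start of `s`. -/
theorem OccAt.right_new (h : OccAt (p ++ c ++ s) x i) (hc : c.length ≤ 1) {a : α}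
    (ha : (p ++ c ++ s)[i + x.length]? = some a) (hx : ¬ x ++ [a] <:+: p ++ b ++ s) :
    i ≤ p.length ∧ p.length ≤ i + x.length := by
  have := (occAt_concat.2 ⟨h, ha⟩).crosses hx
  simp only [List.length_append, List.length_cons, List.length_nil] at this
  omega

theorem OccAt.left_new (h : OccAt (p ++ c ++ s) x i) (hc : c.length ≤ 1)
    (hx : ¬ LeftExt (p ++ b ++ s) x (leftLetter (p ++ c ++ s) i)) :
    i ≤ p.length + c.length ∧ p.length + c.length ≤ i + x.length := by
  rcases i with _ | i
  · refine ⟨by omega, ?_⟩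
    by_contra hi
    have h1 := prefix_iff_occAt.2 (h.of_left (by omega))
    refine hx ?_
    simp only [leftLetter, if_true, LeftExt]
    exact h1.trans (by rw [List.append_assoc]; exact List.prefix_append _ _)
  · have hlt : i < (p ++ c ++ s).length := by have := h.1; omega
    have ha : (p ++ c ++ s)[i]? = some (p ++ c ++ s)[i] := List.getElem?_eq_getElem hlt
    have hx' : ¬ (p ++ c ++ s)[i] :: x <:+: p ++ b ++ s := by
      have hl : leftLetter (p ++ c ++ s) (i + 1) = some (p ++ c ++ s)[i] := ha
      rwa [hl] at hx
    have := (occAt_cons.2 ⟨ha, h⟩).crosses hx'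
    simp only [List.length_cons] at this
    omega

end Edit

theorem exists_occAt_of_leftExt {T x : List α} {o : Option α} (h : LeftExt T x o) :
    ∃ i, OccAt T x i ∧ leftLetter T i = o := by
  cases o with
  | none => exact ⟨0, prefix_iff_occAt.1 h, rfl⟩
  | some a =>
    obtain ⟨i, hi⟩ := infix_iff_occAt.1 h
    rw [occAt_cons] at hi
    exact ⟨i + 1, hi.2, by simpa [leftLetter] using hi.1⟩

theorem exists_left_new {T T' x : List α} (hx : x <:+: T) (hL : ¬ LeftMaximal T x)
    (hL' : LeftMaximal T' x) :
    ∃ i, OccAt T' x i ∧ ¬ LeftExt T x (leftLetter T' i) := by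
  have key : ∃ o, LeftExt T' x o ∧ ¬ LeftExt T x o := by
    obtain ⟨-, ⟨a, b, hab, ha, hb⟩ | h⟩ := hL'
    · by_cases ha' : a :: x <:+: T
      · by_cases hb' : b :: x <:+: T
        · exact absurd ⟨hx, Or.inl ⟨a, b, hab, ha', hb'⟩⟩ hL
        · exact ⟨some b, hb, hb'⟩
      · exact ⟨some a, ha, ha'⟩
    · exact ⟨none, h, fun h' => hL ⟨hx, Or.inr h'⟩⟩
  obtain ⟨o, ho, ho'⟩ := key
  obtain ⟨i, hi, rfl⟩ := exists_occAt_of_leftExt ho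
  exact ⟨i, hi, ho'⟩

theorem exists_occAt_of_mem_rightLetters {T x : List α} {a : α} (h : a ∈ rightLetters T x) :
    ∃ i, OccAt T x i ∧ T[i + x.length]? = some a := by
  obtain ⟨i, hi⟩ := infix_iff_occAt.1 (mem_rightLetters.1 h)
  exact ⟨i, occAt_concat.1 hi⟩

theorem rightLetters_subset_of_suffix {T x y : List α} (h : x <:+ y) :
    rightLetters T y ⊆ rightLetters T x := by
  intro a ha
  rw [mem_rightLetters] at ha ⊢
  obtain ⟨t, rfl⟩ := h
  rw [List.append_assoc] at ha
  exact infix_append_cancel_left ha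

theorem rightMaximal_of_two_le_card {T x : List α} (h : 2 ≤ (rightLetters T x).card) :
    RightMaximal T x := by
  obtain ⟨a, ha, b, hb, hab⟩ := Finset.one_lt_card.1 h
  rw [mem_rightLetters] at ha hb
  exact ⟨infix_append_cancel_right ha, Or.inl ⟨a, b, hab, ha, hb⟩⟩

theorem two_le_card_rightLetters {T x : List α} {a b : α} (hab : a ≠ b)
    (ha : a ∈ rightLetters T x) (hb : b ∈ rightLetters T x) : 2 ≤ (rightLetters T x).card :=
  Finset.one_lt_card.2 ⟨a, ha, b, hb, hab⟩

theorem leftMaximal_of_prefix {T x y : List α} (h : x <+: y) (hy : LeftMaximal T y) :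
    LeftMaximal T x := by
  obtain ⟨t, rfl⟩ := h
  obtain ⟨h1, ⟨a, b, hab, ha, hb⟩ | h2⟩ := hy
  · exact ⟨infix_append_cancel_right h1, Or.inl ⟨a, b, hab,
      infix_append_cancel_right (w := t) (by simpa using ha),
      infix_append_cancel_right (w := t) (by simpa using hb)⟩⟩
  · exact ⟨infix_append_cancel_right h1, Or.inr ((List.prefix_append x t).trans h2)⟩

/-! ### Counting nodes by prefixes of `s` and suffixes of `p` -/

open Classical in
/-- The lengths of the prefixes of `s` that branch in `T`. -/
noncomputable def branchingPrefixes (T s : List α) : Finset ℕ :=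
  (Finset.range s.length).filter fun k => 2 ≤ (rightLetters T (s.take k)).card

open Classical in
/-- Left closure maps the branching prefixes of a factor injectively to the nodes. -/
theorem exists_node_of_branchingPrefix {T s : List α} (hs : s <:+: T) :
    ∃ g : ℕ → List α, Set.InjOn g (branchingPrefixes T s) ∧ ∀ k ∈ branchingPrefixes T s,
      g k ∈ (nodeFinset T).erase T ∧ rightLetters T (g k) = rightLetters T (s.take k) := by
  have htake : ∀ k, s.take k <:+: T := fun k => (List.take_prefix k s).isInfix.trans hs
  choose g hg1 hg2 hg3 hg4 using fun k => exists_left_closure T (s.take k) (htake k)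
  have hA : ∀ k, rightLetters T (g k) = rightLetters T (s.take k) := fun k => by
    ext a
    rw [mem_rightLetters, mem_rightLetters, hg3]
  refine ⟨g, ?_, fun k hk => ⟨?_, hA k⟩⟩
  · have main : ∀ k ∈ branchingPrefixes T s, ∀ l ∈ branchingPrefixes T s, k ≤ l → g k = g l →
        k = l := by
      intro k hk l hl hkl h
      simp only [branchingPrefixes, Finset.mem_filter, Finset.mem_range] at hk hl
      -- Left closure preserves right contexts, so prefixes with a common closure have equal right
      -- contexts and coincide.
      have := eq_of_prefix_of_infix_iff (htake k) (List.take_prefix_take_left hkl)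
        fun w => by rw [hg3, hg3, h]
      have := congrArg List.length this
      simp only [List.length_take] at this
      omega
    intro k hk l hl h
    rcases le_total k l with hkl | hkl
    · exact main k hk l hl hkl h
    · exact (main l hl k hk hkl h.symm).symm
  · have h2 : 2 ≤ (rightLetters T (g k)).card := by
      rw [hA]
      exact (Finset.mem_filter.1 hk).2
    refine Finset.mem_erase.2 ⟨fun h => ?_, mem_nodeFinset.2 ⟨hg2 k, rightMaximal_of_two_le_card h2⟩⟩
    rw [h, rightLetters_self] at h2
    simp at h2

theorem card_branchingPrefixes_lt {T s : List α} (hs : s <:+: T) :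
    (branchingPrefixes T s).card + 1 ≤ (nodeFinset T).card := by
  classical
  obtain ⟨g, hg, hmem⟩ := exists_node_of_branchingPrefix hs
  rw [← Finset.card_erase_add_one (self_mem_nodeFinset T)]
  exact Nat.succ_le_succ (Finset.card_le_card_of_injOn g (fun k hk => (hmem k hk).1) hg)

open Classical in
theorem sum_take_le {T s : List α} (hs : s <:+: T) :
    ∑ k ∈ Finset.range s.length, ((rightLetters T (s.take k)).card - 1) ≤
      ∑ x ∈ (nodeFinset T).erase T, ((rightLetters T x).card - 1) := by
  obtain ⟨g, hg, hmem⟩ := exists_node_of_branchingPrefix hs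
  have h1 : ∑ k ∈ Finset.range s.length, ((rightLetters T (s.take k)).card - 1) =
      ∑ k ∈ branchingPrefixes T s, ((rightLetters T (g k)).card - 1) := by
    rw [branchingPrefixes, Finset.sum_filter]
    refine Finset.sum_congr rfl fun k hk => ?_
    split_ifs with h
    · rw [(hmem k (Finset.mem_filter.2 ⟨hk, h⟩)).2]
    · omega
  rw [h1, ← Finset.sum_image (f := fun x => (rightLetters T x).card - 1) hg]
  refine Finset.sum_le_sum_of_subset fun y hy => ?_
  obtain ⟨k, hk, rfl⟩ := Finset.mem_image.1 hy
  exact (hmem k hk).1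

open Classical in
/-- Right closure maps the left-maximal suffixes of a factor injectively to the nodes. -/
theorem card_leftMaximal_drop_le {T p : List α} (hp : p <:+: T) :
    ((Finset.range (p.length + 1)).filter fun i => LeftMaximal T (p.drop i)).card ≤
      (nodeFinset T).card := by
  have hdrop : ∀ i, p.drop i <:+: T := fun i => (List.drop_suffix i p).isInfix.trans hp
  choose g hg1 hg2 hg3 hg4 using fun i => exists_right_closure T (p.drop i) (hdrop i)
  refine Finset.card_le_card_of_injOn g (fun i hi => ?_) ?_
  · have hi := (Finset.mem_filter.1 hi).2
    refine mem_nodeFinset.2 ⟨?_, hg2 i⟩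
    obtain ⟨h1, ⟨a, b, hab, ha, hb⟩ | h2⟩ := hi
    · exact ⟨(hg2 i).1, Or.inl ⟨a, b, hab, (hg3 i [a]).1 ha, (hg3 i [b]).1 hb⟩⟩
    · exact ⟨(hg2 i).1, Or.inr ((hg4 i []).1 h2)⟩
  · have main : ∀ i j, i ≤ p.length → j ≤ p.length → i ≤ j → g i = g j → i = j := by
      intro i j hi hj hij h
      have := eq_of_suffix_of_infix_iff (hdrop j) (List.drop_suffix_drop_left p hij)
        fun w => by rw [hg3, hg3, h]
      have := congrArg List.length this
      simp only [List.length_drop] at this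
      omega
    intro i hi j hj h
    simp only [Finset.coe_filter, Finset.mem_range, Set.mem_ofPred_eq] at hi hj
    rcases le_total i j with hij | hij
    · exact main i j (by omega) (by omega) hij h
    · exact (main j i (by omega) (by omega) hij h.symm).symm

/-- If prefixes of `s` of certain lengths are suffixes of `p`, then each of these lengths but
the largest can be extended to that of a branching prefix of `s`, in an increasing way. -/
theorem card_borders_le {d : α} {T p s : List α} (hs : EndsUniquely d s) (hsT : s <:+: T)
    (K : Finset ℕ) (hK : ∀ k ∈ K, k < s.length ∧ s.take k <:+ p) :
    K.card ≤ (branchingPrefixes T s).card + 1 := by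
  classical
  rcases K.eq_empty_or_nonempty with rfl | hne
  · simp
  -- The shift aligns the right-hand index with the last position of `s`, which holds the
  -- end-marker; the left-hand index falls on an earlier position.
  have hmis : ∀ k ∈ K, ∀ l ∈ K, k < l → s[k + (s.length - 1 - l)]? ≠ s[l + (s.length - 1 - l)]? := by
    intro k _ l hl hkl heq
    have hl := (hK l hl).1
    obtain ⟨u, hu, rfl⟩ := hs
    simp only [List.length_append, List.length_cons, List.length_nil] at hl heq
    rw [show l + (u.length + (0 + 1) - 1 - l) = u.length by omega, List.getElem?_append_left
      (by omega)] at heq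
    simp only [List.getElem?_concat_length] at heq
    exact hu (List.mem_of_getElem? heq)
  set m := K.max' hne with hm
  have hex : ∀ k ∈ K.erase m, ∃ t, ∃ l ∈ K, k < l ∧ s[k + t]? ≠ s[l + t]? := by
    intro k hk
    obtain ⟨hkm, hk⟩ := Finset.mem_erase.1 hk
    have hlt : k < m := lt_of_le_of_ne (K.le_max' k hk) hkm
    exact ⟨_, m, K.max'_mem hne, hlt, hmis k hk m (K.max'_mem hne) hlt⟩
  -- `L k` is the first offset at which reading `s` from `k` disagrees with reading it from some
  -- larger `l ∈ K`. The value 0 is never used, since an offset exists for every `k` but the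
  -- maximum.
  let L : ℕ → ℕ := fun k => if h : ∃ t, ∃ l ∈ K, k < l ∧ s[k + t]? ≠ s[l + t]? then Nat.find h else 0
  have hL : ∀ k ∈ K.erase m, (∃ l ∈ K, k < l ∧ s[k + L k]? ≠ s[l + L k]?) ∧
      ∀ t < L k, ∀ l ∈ K, k < l → s[k + t]? = s[l + t]? := by
    intro k hk
    have h := hex k hk
    have hLk : L k = Nat.find h := dif_pos h
    refine ⟨by rw [hLk]; exact Nat.find_spec h, fun t ht l hl hkl => ?_⟩
    rw [hLk] at ht
    by_contra hne
    exact Nat.find_min h ht ⟨l, hl, hkl, hne⟩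
  rw [← Finset.card_erase_add_one (K.max'_mem hne)]
  refine Nat.succ_le_succ (Finset.card_le_card_of_injOn (fun k => k + L k) ?_ ?_)
  · intro k hk
    obtain ⟨⟨l, hl, hkl, hne⟩, hagree⟩ := hL k hk
    have hkK := (Finset.mem_erase.1 hk).2
    have hlt : l + L k < s.length := by
      by_contra hge
      exact hmis k hkK l hl hkl (hagree _ (by have := (hK l hl).1; omega) l hl hkl)
    have hsuf : s.take k <:+ s.take l :=
      List.suffix_of_suffix_length_le (hK k hkK).2 (hK l hl).2 (by simp; omega)
    -- The prefix of length `k` ends the prefix of length `l`, and the letters after both agree for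
    -- `L k` steps. So the prefix of length `k + L k` also occurs at `l - k`, followed there by a
    -- different letter than at 0.
    have hocc : OccAt s (s.take (k + L k)) (l - k) := by
      have h1 := (occAt_of_suffix hsuf)
      have hlen1 : (s.take k).length = k := by simp; omega
      have hlen2 : (s.take l).length = l := by simp; omega
      rw [hlen1, hlen2] at h1
      refine ⟨by simp; omega, fun t ht => ?_⟩
      simp only [List.length_take] at ht
      rw [List.getElem?_take_of_lt (by omega)]
      by_cases htk : t < k
      · have := h1.2 t (by omega)
        rwa [List.getElem?_take_of_lt htk, List.getElem?_take_of_lt (by omega)] at this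
      · have := hagree (t - k) (by omega) l hl hkl
        rw [show k + (t - k) = t by omega] at this
        rw [this]
        congr 1; omega
    have hocc0 : OccAt s (s.take (k + L k)) 0 := prefix_iff_occAt.1 (List.take_prefix _ _)
    have hlen : (s.take (k + L k)).length = k + L k := by simp; omega
    have hmem : ∀ i, OccAt s (s.take (k + L k)) i → ∀ h : i + (k + L k) < s.length,
        s[i + (k + L k)] ∈ rightLetters T (s.take (k + L k)) := by
      intro i hi h
      refine mem_rightLetters.2 (List.IsInfix.trans ?_ hsT)
      refine (occAt_concat.2 ⟨hi, ?_⟩).infix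
      rw [hlen]
      exact List.getElem?_eq_getElem h
    have ha := hmem 0 hocc0 (by omega)
    have hb := hmem (l - k) hocc (by omega)
    simp only [branchingPrefixes, Finset.coe_filter, Finset.mem_range, Set.mem_ofPred_eq]
    refine ⟨by omega, two_le_card_rightLetters ?_ ha hb⟩
    intro heq
    apply hne
    rw [List.getElem?_eq_getElem (by omega), List.getElem?_eq_getElem hlt]
    simp only [Option.some.injEq]
    convert heq using 2 <;> omega
  · have main : ∀ k ∈ K.erase m, ∀ l ∈ K.erase m, k < l → k + L k < l + L l := by
      intro k hk l hl hkl
      -- If `l` first disagrees with `j` at an offset smaller than `L k`, then `k` agrees with both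
      -- `l` and `j` there, a contradiction.
      have hle : L k ≤ L l := by
        by_contra hlt
        obtain ⟨j, hj, hlj, hne⟩ := (hL l hl).1
        have hagree := (hL k hk).2 (L l) (by omega)
        exact hne ((hagree l (Finset.mem_erase.1 hl).2 hkl).symm.trans
          (hagree j hj (hkl.trans hlj)))
      omega
    intro k hk l hl h
    simp only at h
    rcases lt_trichotomy k l with hkl | hkl | hkl
    · have := main k hk l hl hkl; omega
    · exact hkl
    · have := main l hl k hk hkl; omega

/-! ### Branching pairs -/

/-- Two occurrences of `x` in `T` around the window from `P` to `C` that differ both in the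
letter before and in the letter after `x`. -/
structure BranchingPair (T : List α) (P C : ℕ) (x : List α) (i j : ℕ) : Prop where
  lt : i < j
  occ_left : OccAt T x i
  occ_right : OccAt T x j
  le_left : P ≤ i + x.length
  right_le : j ≤ C
  left_ne : leftLetter T i ≠ leftLetter T j
  right_ne : T[i + x.length]? ≠ T[j + x.length]?

/-- The distance of a branching pair determines the pair and the string. -/
theorem BranchingPair.unique {T x y : List α} {P C i i' D : ℕ} (hC : C ≤ P + 1)
    (h : BranchingPair T P C x i (i + D)) (h' : BranchingPair T P C y i' (i' + D)) :
    i = i' ∧ x = y := by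
  -- For fixed `D`, `x` fills a maximal interval on which `T` agrees with its shift by `D`. Since `C
  -- ≤ P + 1` and `D > 0`, the interval starts at or before `P` and ends at or after `P`, so there
  -- is only one.
  have same_start : ∀ {x y : List α} {i i' : ℕ}, BranchingPair T P C x i (i + D) →
      BranchingPair T P C y i' (i' + D) → ¬ i < i' := by
    intro x y i i' h h' hlt
    have h1 := h.lt
    have h2 := h'.right_le
    have h3 := h.le_left
    have e1 := h.occ_left.2 (i' - 1 - i) (by omega)
    have e2 := h.occ_right.2 (i' - 1 - i) (by omega)
    apply h'.left_ne
    rw [leftLetter, leftLetter, if_neg (by omega), if_neg (by omega)]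
    rw [← e2, show i + (i' - 1 - i) = i' - 1 by omega,
      show i + D + (i' - 1 - i) = i' + D - 1 by omega] at e1
    exact e1
  have same_end : ∀ {x y : List α}, BranchingPair T P C x i (i + D) →
      BranchingPair T P C y i (i + D) → ¬ x.length < y.length := by
    intro x y h h' hlt
    exact h.right_ne ((h'.occ_left.2 _ hlt).trans (h'.occ_right.2 _ hlt).symm)
  have hi : i = i' := by
    have := same_start h h'
    have := same_start h' h
    omega
  subst hi
  refine ⟨rfl, h.occ_left.eq_of_length_eq h'.occ_left ?_⟩
  have := same_end h h'
  have := same_end h' h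
  omega

/-- Of three occurrences of `x` that overlap or touch, the first two are followed by the same
letter. -/
theorem OccAt.getElem?_eq_of_three {T x : List α} {i j k : ℕ} (hi : OccAt T x i)
    (hj : OccAt T x j) (hk : OccAt T x k) (hij : i < j) (hjk : j < k) (hle : k ≤ i + x.length) :
    T[i + x.length]? = T[j + x.length]? := by
  -- Both letters equal the letter of `x` at index `x.length - (k - i)`; the index is not truncated
  -- because `k ≤ i + x.length`.
  have e1 := hj.2 (x.length - (j - i)) (by omega)
  have e2 := hk.2 (x.length - (k - j)) (by omega)
  have e3 := hi.2 (x.length - (k - j)) (by omega)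
  have e4 := hj.2 (x.length - (k - i)) (by omega)
  have e5 := hk.2 (x.length - (k - i)) (by omega)
  rw [show j + (x.length - (j - i)) = i + x.length by omega] at e1
  rw [show k + (x.length - (k - j)) = j + x.length by omega] at e2
  rw [show j + (x.length - (k - i)) = i + (x.length - (k - j)) by omega] at e4
  rw [show k + (x.length - (k - i)) = j + (x.length - (j - i)) by omega] at e5
  rw [show j + (x.length - (j - i)) = i + x.length by omega] at e5
  rw [e2, ← e3, e4, e5]

/-- Otherwise points with different `f` share `g`. As `f` takes two values, any point is linked to
`i` directly or through `j`, and `g` is constant. -/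
theorem exists_ne_and_ne {ι β γ : Type*} {O : ι → Prop} {f : ι → β} {g : ι → γ}
    (hf : ∃ i j, O i ∧ O j ∧ f i ≠ f j) (hg : ∃ i j, O i ∧ O j ∧ g i ≠ g j) :
    ∃ i j, O i ∧ O j ∧ f i ≠ f j ∧ g i ≠ g j := by
  obtain ⟨i, j, hi, hj, hij⟩ := hf
  obtain ⟨k, l, hk, hl, hkl⟩ := hg
  by_contra! H
  have h1 := H i j hi hj hij
  have key : ∀ m, O m → g m = g i := by
    intro m hm
    by_cases hmi : f m = f i
    · rw [H m j hm hj (hmi ▸ hij), h1]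
    · exact H m i hm hi hmi
  exact hkl ((key k hk).trans (key l hl).symm)

/-! ### New right letters -/

section Edit

variable {d : α} {p b c s : List α}

open Classical in
/-- The right letters of `x` in `T'` that are not right letters in `T`. -/
noncomputable def newLetters (T T' x : List α) : Finset α := rightLetters T' x \ rightLetters T x

theorem mem_newLetters {T T' x : List α} {a : α} :
    a ∈ newLetters T T' x ↔ a ∈ rightLetters T' x ∧ ¬ x ++ [a] <:+: T := by
  simp [newLetters]

theorem card_rightLetters_le (T T' x : List α) :
    (rightLetters T' x).card ≤ (rightLetters T x).card + (newLetters T T' x).card := by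
  classical
  rw [add_comm, newLetters]
  exact Finset.card_le_card_sdiff_add_card

/-- `x` occurs in `T'` at position `i` with a left context that it does not have in `T`. -/
def LeftNew (T T' x : List α) (i : ℕ) : Prop :=
  OccAt T' x i ∧ ¬ LeftExt T x (leftLetter T' i)

-- A new letter is charged to the start `i ≤ p.length` of an occurrence it follows. There `p.drop i`
-- is a prefix of the left-maximal `x`, hence left-maximal, and right closure sends such suffixes of
-- `p` injectively to nodes.
open Classical in
theorem sum_newLetters_le (hc : c.length ≤ 1) (S : Finset (List α))
    (hS : ∀ x ∈ S, LeftMaximal (p ++ b ++ s) x) :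
    ∑ x ∈ S, (newLetters (p ++ b ++ s) (p ++ c ++ s) x).card ≤
      (nodeFinset (p ++ b ++ s)).card := by
  set T := p ++ b ++ s with hT
  set T' := p ++ c ++ s with hT'
  let st : List α → Finset ℕ := fun x => (Finset.range (p.length + 1)).filter fun i =>
    p.length ≤ i + x.length ∧ OccAt T' x i ∧ ∃ a, T'[i + x.length]? = some a ∧ ¬ x ++ [a] <:+: T
  have h1 : ∀ x, (newLetters T T' x).card ≤ (st x).card := by
    intro x
    have h : ∀ a ∈ newLetters T T' x, ∃ i ∈ st x, T'[i + x.length]? = some a := by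
      intro a ha
      obtain ⟨ha, hn⟩ := mem_newLetters.1 ha
      obtain ⟨i, hi, hia⟩ := exists_occAt_of_mem_rightLetters ha
      have := hi.right_new hc hia hn
      exact ⟨i, Finset.mem_filter.2 ⟨by simp; omega, this.2, hi, a, hia, hn⟩, hia⟩
    choose! f hf hf' using h
    refine Finset.card_le_card_of_injOn f hf fun a ha a' ha' heq => ?_
    have := hf' a ha
    rw [heq, hf' a' ha'] at this
    simpa using this.symm
  refine (Finset.sum_le_sum fun x _ => h1 x).trans ?_
  rw [← Finset.card_biUnion]
  · have hp : p <:+: T := by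
      rw [hT, List.append_assoc]
      exact (List.prefix_append _ _).isInfix
    refine (Finset.card_le_card fun i hi => ?_).trans (card_leftMaximal_drop_le hp)
    obtain ⟨x, hx, hi⟩ := Finset.mem_biUnion.1 hi
    obtain ⟨hip, hle, hocc, -⟩ := Finset.mem_filter.1 hi
    refine Finset.mem_filter.2 ⟨hip, leftMaximal_of_prefix ?_ (hS x hx)⟩
    simp only [Finset.mem_range] at hip
    rw [prefix_iff_occAt]
    have h0 : OccAt T' (p.drop i) i := by
      have hp0 : OccAt T' p 0 := by simpa [hT'] using occAt_append [] p (c ++ s)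
      have := hp0.trans (occAt_of_suffix (List.drop_suffix i p))
      simpa [show p.length - (p.length - i) = i by omega] using this
    simpa using hocc.restrict h0 le_rfl (by simp; omega)
  -- If `x` and a longer `y` shared a start, `y` would contain `x` with its new letter; but `y`
  -- occurs in `T`.
  · have main : ∀ x y i, i ∈ st x → i ∈ st y → LeftMaximal T y → ¬ x.length < y.length := by
      intro x y i hx hy hL hlt
      obtain ⟨-, -, hx, a, ha, hn⟩ := Finset.mem_filter.1 hx
      obtain ⟨-, -, hy, -⟩ := Finset.mem_filter.1 hy
      exact hn (((hy.restrict (occAt_concat.2 ⟨hx, ha⟩) le_rfl (by simp; omega)).infix).trans hL.1)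
    intro x hx y hy hxy
    rw [Function.onFun, Finset.disjoint_left]
    intro i hix hiy
    have h2 := main x y i hix hiy (hS y hy)
    have h3 := main y x i hiy hix (hS x hx)
    exact hxy ((Finset.mem_filter.1 hix).2.2.1.eq_of_length_eq (Finset.mem_filter.1 hiy).2.2.1
      (by omega))

open Classical in
/-- The new right letters that also occur after a new left context. -/
noncomputable def coveredLetters (T T' x : List α) : Finset α :=
  (newLetters T T' x).filter fun a => ∃ i, LeftNew T T' x i ∧ T'[i + x.length]? = some a

theorem infix_right (p b s : List α) : s <:+: p ++ b ++ s := (List.suffix_append _ _).isInfix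

theorem getElem?_append_append (p c s : List α) (k : ℕ) :
    (p ++ c ++ s)[p.length + c.length + k]? = s[k]? := by
  rw [List.getElem?_append_right (by simp)]
  congr 1
  simp

-- An occurrence of `x` with a new left context ends inside `s`, after `k` of its letters, so
-- `s.take k` is a suffix of `x` and inherits its right letters. If the next letter `s[k]` is new
-- for `x`, the inclusion is strict, which pays for that covered letter.
open Classical in
theorem sum_coveredLetters_le (hc : c.length ≤ 1) (hTe : EndsUniquely d (p ++ b ++ s))
    (hT' : EndsUniquely d (p ++ c ++ s)) (S : Finset (List α))
    (hS : ∀ x ∈ S, x <:+: p ++ b ++ s ∧ ¬ LeftMaximal (p ++ b ++ s) x ∧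
      LeftMaximal (p ++ c ++ s) x ∧ d ∉ x) :
    ∑ x ∈ S, ((rightLetters (p ++ b ++ s) x).card - 1 +
        (coveredLetters (p ++ b ++ s) (p ++ c ++ s) x).card) ≤
      ∑ k ∈ Finset.range s.length, ((rightLetters (p ++ b ++ s) (s.take k)).card - 1) := by
  set T := p ++ b ++ s with hT
  set T' := p ++ c ++ s with hTT'
  let en : List α → Finset ℕ := fun x => (Finset.range s.length).filter fun k =>
    ∃ i, LeftNew T T' x i ∧ i + x.length = p.length + c.length + k
  have hen : ∀ x ∈ S, ∀ i, LeftNew T T' x i →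
      ∃ k ∈ en x, i + x.length = p.length + c.length + k := by
    intro x hx i hi
    have h1 := hi.1.left_new hc hi.2
    have h2 : i + x.length < T'.length := by
      refine lt_of_le_of_ne hi.1.1 fun h => ?_
      have hsuf := suffix_of_occAt hi.1 h
      rcases eq_or_ne x [] with rfl | hne
      · exact (hS _ hx).2.1 ⟨List.nil_infix, Or.inr List.nil_prefix⟩
      · exact (hS x hx).2.2.2 (hT'.mem_of_suffix hsuf hne)
    simp only [hTT', List.length_append] at h2
    refine ⟨i + x.length - (p.length + c.length), Finset.mem_filter.2 ⟨by simp; omega, i, hi, ?_⟩,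
      ?_⟩ <;> omega
  have hsuf : ∀ x k i, LeftNew T T' x i → i + x.length = p.length + c.length + k →
      k < s.length → s.take k <:+ x := by
    intro x k i hi hk hks
    have h1 := hi.1.left_new hc hi.2
    have h0 : OccAt T' (s.take k) (p.length + c.length) := by
      simpa [hTT'] using (occAt_right p c s).trans (prefix_iff_occAt.1 (List.take_prefix k s))
    have h2 := hi.1.restrict h0 h1.1 (by simp; omega)
    exact suffix_of_occAt h2 (by simp; omega)
  have hx : ∀ x ∈ S, (rightLetters T x).card - 1 + (coveredLetters T T' x).card ≤
      ∑ k ∈ en x, ((rightLetters T (s.take k)).card - 1) := by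
    intro x hx
    have hpos := (en x).card_pos.2 (by
      obtain ⟨i, hi⟩ := exists_left_new (hS x hx).1 (hS x hx).2.1 (hS x hx).2.2.1
      obtain ⟨k, hk, -⟩ := hen x hx i hi
      exact ⟨k, hk⟩)
    have hcov : (coveredLetters T T' x).card ≤
        ((en x).filter fun k => ∃ a ∈ newLetters T T' x, s[k]? = some a).card := by
      have h : ∀ a ∈ coveredLetters T T' x, ∃ k ∈ (en x).filter fun k =>
          ∃ a ∈ newLetters T T' x, s[k]? = some a, s[k]? = some a := by
        intro a ha
        obtain ⟨ha, i, hi, hia⟩ := Finset.mem_filter.1 ha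
        obtain ⟨k, hk, hik⟩ := hen x hx i hi
        rw [hik, hTT', getElem?_append_append] at hia
        exact ⟨k, Finset.mem_filter.2 ⟨hk, a, ha, hia⟩, hia⟩
      choose! f hf hf' using h
      refine Finset.card_le_card_of_injOn f hf fun a ha a' ha' heq => ?_
      have := hf' a ha
      rw [heq, hf' a' ha'] at this
      simpa using this.symm
    have hterm : ∀ k ∈ en x, (rightLetters T x).card - 1 +
        (if ∃ a ∈ newLetters T T' x, s[k]? = some a then 1 else 0) ≤
        (rightLetters T (s.take k)).card - 1 := by
      intro k hk
      obtain ⟨hks, i, hi, hik⟩ := Finset.mem_filter.1 hk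
      rw [Finset.mem_range] at hks
      have hsub := rightLetters_subset_of_suffix (T := T) (hsuf x k i hi hik hks)
      split_ifs with h
      · obtain ⟨a, ha, hka⟩ := h
        have hn := (mem_newLetters.1 ha).2
        have hmem : a ∈ rightLetters T (s.take k) := by
          refine mem_rightLetters.2 (List.IsInfix.trans ?_ (infix_right p b s))
          refine (occAt_concat (i := 0).2 ⟨prefix_iff_occAt.1 (List.take_prefix k s), ?_⟩).infix
          rw [List.length_take, min_eq_left hks.le, zero_add, hka]
        have hlt : (rightLetters T x).card < (rightLetters T (s.take k)).card :=
          Finset.card_lt_card ⟨hsub, fun h => hn (mem_rightLetters.1 (h hmem))⟩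
        have hposx : 0 < (rightLetters T x).card :=
          (hTe.rightLetters_nonempty (hS x hx).1 (hS x hx).2.2.2).card_pos
        omega
      · have := Finset.card_le_card hsub
        omega
    calc (rightLetters T x).card - 1 + (coveredLetters T T' x).card
        ≤ (en x).card * ((rightLetters T x).card - 1) +
          ((en x).filter fun k => ∃ a ∈ newLetters T T' x, s[k]? = some a).card :=
          Nat.add_le_add (Nat.le_mul_of_pos_left _ hpos) hcov
      _ = ∑ k ∈ en x, ((rightLetters T x).card - 1 +
          (if ∃ a ∈ newLetters T T' x, s[k]? = some a then 1 else 0)) := by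
          rw [Finset.sum_add_distrib, Finset.sum_const, smul_eq_mul, Finset.card_filter _ (en x)]
      _ ≤ _ := Finset.sum_le_sum hterm
  refine (Finset.sum_le_sum hx).trans ?_
  rw [← Finset.sum_biUnion]
  · refine Finset.sum_le_sum_of_subset fun k hk => ?_
    obtain ⟨x, -, hk⟩ := Finset.mem_biUnion.1 hk
    exact (Finset.mem_filter.1 hk).1
  -- Of two strings ending at the same place, the longer contains the shorter together with its new
  -- left letter; yet the longer one occurs in `T`.
  · have main : ∀ x y i j, x <:+: T → LeftNew T T' x i → LeftNew T T' y j →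
        i + x.length = j + y.length → ¬ y.length < x.length := by
      intro x y i j hx hi hj hij hlt
      have hlt' : j - 1 < T'.length := by have := hj.1.1; omega
      have ha : T'[j - 1]? = some T'[j - 1] := List.getElem?_eq_getElem hlt'
      have h1 : OccAt T' (T'[j - 1] :: y) (j - 1) := by
        refine occAt_cons.2 ⟨ha, ?_⟩
        rw [show j - 1 + 1 = j by omega]
        exact hj.1
      have h2 := (hi.1.restrict h1 (by omega) (by simp; omega)).infix.trans hx
      apply hj.2
      rw [leftLetter, if_neg (by omega), ha]
      exact h2
    intro x hx y hy hxy
    rw [Function.onFun, Finset.disjoint_left]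
    intro k hkx hky
    obtain ⟨-, i, hi, hik⟩ := Finset.mem_filter.1 hkx
    obtain ⟨-, j, hj, hjk⟩ := Finset.mem_filter.1 hky
    have h2 := main x y i j (hS x hx).1 hi hj (by omega)
    have h3 := main y x j i (hS y hy).1 hj hi (by omega)
    obtain rfl : i = j := by omega
    exact hxy (hi.1.eq_of_length_eq hj.1 (by omega))

end Edit

/-! ### Charging to the distances of branching pairs -/

section Edit

variable {d : α} {p b c s : List α}

open Classical in
/-- The distances, less `C - P`, of the branching pairs of `x`. -/
noncomputable def pairDistances (T : List α) (P C : ℕ) (x : List α) : Finset ℕ :=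
  (Finset.range (P + 1)).filter fun k => ∃ i, BranchingPair T P C x i (i + (k + (C - P)))

theorem BranchingPair.mem_pairDistances {T x : List α} {P C i j : ℕ} (hP : P ≤ C)
    (hC : C ≤ P + 1) (h : BranchingPair T P C x i j) :
    ∃ k ∈ pairDistances T P C x, j = i + (k + (C - P)) := by
  classical
  have h1 := h.lt
  have h2 := h.right_le
  -- `j - i ≥ 1 ≥ C - P`, so no subtraction is truncated.
  have hj : j = i + (j - i - (C - P) + (C - P)) := by omega
  exact ⟨j - i - (C - P), Finset.mem_filter.2 ⟨by simp; omega, i, hj ▸ h⟩, hj⟩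

/-- The shift by `k + c.length` carries the last `k` positions of `p` to the first `k` of `s`, and
both lie in the two occurrences. The end-marker of `s` is not in `p`, so `k` cannot reach it. -/
theorem BranchingPair.take_suffix (hs : EndsUniquely d s) (hp : d ∉ p) {x : List α} {i k : ℕ}
    (h : BranchingPair (p ++ c ++ s) p.length (p.length + c.length) x i (i + (k + c.length))) :
    k < s.length ∧ s.take k <:+ p := by
  have h1 := h.right_le
  have h2 := h.le_left
  have hagree : ∀ t < k, s[t]? = p[p.length - k + t]? := by
    intro t ht
    have e1 := h.occ_left.2 (p.length - k + t - i) (by omega)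
    have e2 := h.occ_right.2 (p.length - k + t - i) (by omega)
    rw [← e1, show i + (k + c.length) + (p.length - k + t - i) = p.length + c.length + t by omega,
      getElem?_append_append, show i + (p.length - k + t - i) = p.length - k + t by omega,
      List.append_assoc, List.getElem?_append_left (by omega)] at e2
    exact e2
  have hk : k < s.length := by
    by_contra hk
    obtain ⟨u, hu, rfl⟩ := hs
    simp only [List.length_append, List.length_cons, List.length_nil] at hk
    have := hagree u.length (by omega)
    simp only [List.getElem?_concat_length] at this
    exact hp (List.mem_of_getElem? this.symm)
  refine ⟨hk, ?_⟩
  have hlen : (s.take k).length = k := by simp; omega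
  have hocc : OccAt p (s.take k) (p.length - k) := by
    refine ⟨by omega, fun t ht => ?_⟩
    rw [hlen] at ht
    rw [List.getElem?_take_of_lt ht, hagree t ht]
  exact suffix_of_occAt hocc (by omega)

open Classical in
theorem sum_pairDistances_le (hs : EndsUniquely d s) (hp : d ∉ p) (hc : c.length ≤ 1)
    (S : Finset (List α)) :
    ∑ x ∈ S, (pairDistances (p ++ c ++ s) p.length (p.length + c.length) x).card ≤
      (branchingPrefixes (p ++ b ++ s) s).card + 1 := by
  rw [← Finset.card_biUnion]
  · refine card_borders_le (p := p) hs (infix_right p b s) _ fun k hk => ?_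
    obtain ⟨x, -, hk⟩ := Finset.mem_biUnion.1 hk
    obtain ⟨-, i, hi⟩ := Finset.mem_filter.1 hk
    rw [Nat.add_sub_cancel_left] at hi
    exact hi.take_suffix hs hp
  · intro x _ y _ hxy
    rw [Function.onFun, Finset.disjoint_left]
    intro k hx hy
    obtain ⟨-, i, hi⟩ := Finset.mem_filter.1 hx
    obtain ⟨-, j, hj⟩ := Finset.mem_filter.1 hy
    exact hxy (hi.unique (by omega) hj).2

/-- Fix one occurrence `i₀` with a new left context. An occurrence followed by an uncovered new
letter differs from it in both neighbouring letters, so the two form a branching pair, whose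
distance determines the letter. -/
theorem card_newLetters_le (hc : c.length ≤ 1) {x : List α} (hx : x <:+: p ++ b ++ s)
    (hL : ¬ LeftMaximal (p ++ b ++ s) x) (hL' : LeftMaximal (p ++ c ++ s) x) :
    (newLetters (p ++ b ++ s) (p ++ c ++ s) x).card ≤
      (coveredLetters (p ++ b ++ s) (p ++ c ++ s) x).card +
        (pairDistances (p ++ c ++ s) p.length (p.length + c.length) x).card := by
  classical
  set T := p ++ b ++ s with hT
  set T' := p ++ c ++ s with hT'
  set P := p.length with hP
  set C := p.length + c.length with hC
  obtain ⟨i₀, hi₀, hnew⟩ := exists_left_new hx hL hL'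
  have hb₀ := hi₀.left_new hc hnew
  have key : ∀ a ∈ newLetters T T' x \ coveredLetters T T' x,
      ∃ k ∈ pairDistances T' P C x,
        (BranchingPair T' P C x i₀ (i₀ + (k + (C - P))) ∧
          T'[i₀ + (k + (C - P)) + x.length]? = some a) ∨
        ∃ j, i₀ = j + (k + (C - P)) ∧ BranchingPair T' P C x j i₀ ∧
          T'[j + x.length]? = some a := by
    intro a ha
    obtain ⟨ha, hna⟩ := Finset.mem_sdiff.1 ha
    have hna' : ∀ i, LeftNew T T' x i → T'[i + x.length]? ≠ some a :=
      fun i hi h => hna (Finset.mem_filter.2 ⟨ha, i, hi, h⟩)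
    obtain ⟨ha', hn⟩ := mem_newLetters.1 ha
    obtain ⟨j, hj, hja⟩ := exists_occAt_of_mem_rightLetters ha'
    have hb := hj.right_new hc hja hn
    have hleft : leftLetter T' j ≠ leftLetter T' i₀ := by
      intro h
      exact hna' j ⟨hj, h ▸ hnew⟩ hja
    have hright : T'[j + x.length]? ≠ T'[i₀ + x.length]? := by
      rw [hja]
      exact (hna' i₀ ⟨hi₀, hnew⟩).symm
    rcases lt_trichotomy j i₀ with hlt | rfl | hlt
    · have hpair : BranchingPair T' P C x j i₀ :=
        ⟨hlt, hj, hi₀, by omega, by omega, hleft, hright⟩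
      obtain ⟨k, hk, hk'⟩ := hpair.mem_pairDistances (by omega) (by omega)
      exact ⟨k, hk, Or.inr ⟨j, hk', hpair, hja⟩⟩
    · exact absurd rfl hleft
    · have hpair : BranchingPair T' P C x i₀ j :=
        ⟨hlt, hi₀, hj, by omega, by omega, hleft.symm, hright.symm⟩
      obtain ⟨k, hk, rfl⟩ := hpair.mem_pairDistances (by omega) (by omega)
      exact ⟨k, hk, Or.inl ⟨hpair, hja⟩⟩
  have hcard : (newLetters T T' x \ coveredLetters T T' x).card ≤ (pairDistances T' P C x).card := by
    choose! f hf hf' using key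
    refine Finset.card_le_card_of_injOn f hf fun a ha a' ha' heq => ?_
    have h1 := hf' a ha
    have h2 := hf' a' ha'
    rw [← heq] at h2
    generalize f a = k at h1 h2
    -- The distance also tells on which side of `i₀` the other occurrence lies: a pair starting at
    -- `i₀` and one ending there cannot share it.
    have hinj : ∀ {i j}, BranchingPair T' P C x i (i + (k + (C - P))) →
        BranchingPair T' P C x j (j + (k + (C - P))) → i = j :=
      fun h h' => (h.unique (by omega) h').1
    rcases h1 with ⟨h1, e1⟩ | ⟨j, hj, h1, e1⟩ <;> rcases h2 with ⟨h2, e2⟩ | ⟨j', hj', h2, e2⟩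
    · simpa using e1.symm.trans e2
    · have := hinj h1 (hj' ▸ h2)
      have := h2.lt
      omega
    · have := hinj h2 (hj ▸ h1)
      have := h1.lt
      omega
    · obtain rfl : j = j' := by omega
      simpa using e1.symm.trans e2
  have := Finset.card_le_card_sdiff_add_card (s := newLetters T T' x) (t := coveredLetters T T' x)
  omega

/-- All occurrences of `x` cross the edit and hence overlap, which leaves at most two right letters;
if there are two, left-maximality provides a branching pair. -/
theorem card_rightLetters_pred_le (hc : c.length ≤ 1) {x : List α} (hx : ¬ x <:+: p ++ b ++ s)
    (hL' : LeftMaximal (p ++ c ++ s) x) :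
    (rightLetters (p ++ c ++ s) x).card - 1 ≤
      (pairDistances (p ++ c ++ s) p.length (p.length + c.length) x).card := by
  classical
  set T' := p ++ c ++ s with hT'
  have hcross : ∀ i, OccAt T' x i → i < p.length + c.length ∧ p.length < i + x.length :=
    fun i hi => hi.crosses hx
  by_cases h2 : (rightLetters T' x).card ≤ 1
  · omega
  obtain ⟨a, ha, a', ha', haa⟩ := Finset.one_lt_card.1 (not_le.1 h2)
  obtain ⟨i, hi, hia⟩ := exists_occAt_of_mem_rightLetters ha
  obtain ⟨i', hi', hia'⟩ := exists_occAt_of_mem_rightLetters ha'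
  have hright : ∃ i j, OccAt T' x i ∧ OccAt T' x j ∧ T'[i + x.length]? ≠ T'[j + x.length]? :=
    ⟨i, i', hi, hi', by rw [hia, hia']; simpa using haa⟩
  have hleft : ∃ i j, OccAt T' x i ∧ OccAt T' x j ∧ leftLetter T' i ≠ leftLetter T' j := by
    obtain ⟨-, ⟨e, f, hef, he, hf⟩ | h⟩ := hL'
    · obtain ⟨j, hj, hje⟩ := exists_occAt_of_leftExt (o := some e) he
      obtain ⟨j', hj', hjf⟩ := exists_occAt_of_leftExt (o := some f) hf
      exact ⟨j, j', hj, hj', by rw [hje, hjf]; simpa using hef⟩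
    · have hne : i ≠ i' := by
        rintro rfl
        rw [hia] at hia'
        exact haa (by simpa using hia')
      have hpos : ∃ j, OccAt T' x j ∧ j ≠ 0 := by
        by_cases h0 : i = 0
        · exact ⟨i', hi', by omega⟩
        · exact ⟨i, hi, h0⟩
      obtain ⟨j, hj, hj0⟩ := hpos
      refine ⟨0, j, prefix_iff_occAt.1 h, hj, ?_⟩
      have hlt : j - 1 < T'.length := by have := hj.1; omega
      simp [leftLetter, hj0, hlt]
  have hpair : ∃ i j, BranchingPair T' p.length (p.length + c.length) x i j := by
    obtain ⟨i, j, hi, hj, hl, hr⟩ := exists_ne_and_ne hleft hright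
    have hci := hcross i hi
    have hcj := hcross j hj
    rcases lt_trichotomy i j with hij | rfl | hij
    · exact ⟨i, j, hij, hi, hj, by omega, by omega, hl, hr⟩
    · exact absurd rfl hl
    · exact ⟨j, i, hij, hj, hi, by omega, by omega, hl.symm, hr.symm⟩
  have hpos : 0 < (pairDistances T' p.length (p.length + c.length) x).card := by
    obtain ⟨i, j, h⟩ := hpair
    obtain ⟨k, hk, -⟩ := h.mem_pairDistances (by omega) (by omega)
    exact Finset.card_pos.2 ⟨k, hk⟩
  -- An occurrence strictly between the first and the last is followed by the same letter as the
  -- first.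
  have htwo : (rightLetters T' x).card ≤ 2 := by
    let O := (Finset.range (T'.length + 1)).filter (OccAt T' x)
    have hO : ∀ i, OccAt T' x i → i ∈ O := fun i hi =>
      Finset.mem_filter.2 ⟨by have := hi.1; simp; omega, hi⟩
    have hO' : ∀ i ∈ O, OccAt T' x i := fun i hi => (Finset.mem_filter.1 hi).2
    have hne : O.Nonempty := ⟨i, hO i hi⟩
    rw [← Finset.card_image_of_injective _ (Option.some_injective α)]
    refine (Finset.card_le_card (t := {T'[O.min' hne + x.length]?, T'[O.max' hne + x.length]?})
      fun o ho => ?_).trans Finset.card_le_two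
    obtain ⟨e, he, rfl⟩ := Finset.mem_image.1 ho
    obtain ⟨j, hj, hje⟩ := exists_occAt_of_mem_rightLetters he
    rw [← hje, Finset.mem_insert, Finset.mem_singleton]
    have hmin := hO' _ (O.min'_mem hne)
    have hmax := hO' _ (O.max'_mem hne)
    rcases (O.min'_le j (hO j hj)).eq_or_lt with h1 | h1
    · exact Or.inl (by rw [h1])
    rcases (O.le_max' j (hO j hj)).eq_or_lt with h2 | h2
    · exact Or.inr (by rw [← h2])
    have := hcross _ hmin
    have := hcross _ hmax
    exact Or.inl (hmin.getElem?_eq_of_three hj hmax h1 h2 (by omega)).symm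
  omega

/-! ### Assembling the four accounts -/

open Classical in
theorem sum_rightLetters_pred_le (hs : EndsUniquely d s) (hp : d ∉ p) (hc : c.length ≤ 1)
    (hT : EndsUniquely d (p ++ b ++ s)) (hT' : EndsUniquely d (p ++ c ++ s)) :
    ∑ x ∈ (nodeFinset (p ++ c ++ s)).erase (p ++ c ++ s),
        ((rightLetters (p ++ c ++ s) x).card - 1) ≤ 2 * size (p ++ b ++ s) + 2 := by
  set T := p ++ b ++ s with hTdef
  set T' := p ++ c ++ s with hTdef'
  set W := (nodeFinset T').erase T' with hW
  have hWd : ∀ x ∈ W, d ∉ x := fun x hx => notMem_of_mem_erase hT' hx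
  have hWm : ∀ x ∈ W, MaximalSubstring T' x := fun x hx =>
    mem_nodeFinset.1 (Finset.mem_of_mem_erase hx)
  -- A string that is left-maximal but not right-maximal in `T` has at most one right letter there,
  -- so it owes only its new letters.
  have hterm : ∀ x ∈ W, (rightLetters T' x).card - 1 ≤
      (if MaximalSubstring T x then (rightLetters T x).card - 1 else 0) +
      (if LeftMaximal T x then (newLetters T T' x).card else 0) +
      (if x <:+: T ∧ ¬ LeftMaximal T x then
        (rightLetters T x).card - 1 + (coveredLetters T T' x).card else 0) +
      (pairDistances T' p.length (p.length + c.length) x).card := by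
    intro x hx
    have hle := card_rightLetters_le T T' x
    by_cases hxT : x <:+: T
    · have hpos := (hT.rightLetters_nonempty hxT (hWd x hx)).card_pos
      by_cases hL : LeftMaximal T x
      · rw [if_pos hL]
        by_cases hR : RightMaximal T x
        · rw [if_pos ⟨hL, hR⟩]
          omega
        · have : ¬ 2 ≤ (rightLetters T x).card := fun h => hR (rightMaximal_of_two_le_card h)
          omega
      · rw [if_pos (⟨hxT, hL⟩ : _ ∧ _)]
        have := card_newLetters_le hc hxT hL (hWm x hx).1
        rw [← hTdef, ← hTdef'] at this
        omega
    · have := card_rightLetters_pred_le hc hxT (hWm x hx).1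
      rw [← hTdef'] at this
      omega
  have h1 : ∑ x ∈ W, (if MaximalSubstring T x then (rightLetters T x).card - 1 else 0) ≤
      ∑ x ∈ (nodeFinset T).erase T, ((rightLetters T x).card - 1) := by
    rw [← Finset.sum_filter]
    refine Finset.sum_le_sum_of_subset fun x hx => ?_
    obtain ⟨hx, hm⟩ := Finset.mem_filter.1 hx
    refine Finset.mem_erase.2 ⟨?_, mem_nodeFinset.2 hm⟩
    rintro rfl
    exact hWd _ hx hT.mem
  have h2 : ∑ x ∈ W, (if LeftMaximal T x then (newLetters T T' x).card else 0) ≤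
      (nodeFinset T).card := by
    rw [← Finset.sum_filter]
    exact sum_newLetters_le hc _ fun x hx => (Finset.mem_filter.1 hx).2
  have h3 : ∑ x ∈ W, (if x <:+: T ∧ ¬ LeftMaximal T x then
      (rightLetters T x).card - 1 + (coveredLetters T T' x).card else 0) ≤
      ∑ x ∈ (nodeFinset T).erase T, ((rightLetters T x).card - 1) := by
    rw [← Finset.sum_filter]
    refine (sum_coveredLetters_le hc hT hT' _ fun x hx => ?_).trans (sum_take_le (infix_right p b s))
    obtain ⟨hx, hxT, hL⟩ := Finset.mem_filter.1 hx
    exact ⟨hxT, hL, (hWm x hx).1, hWd x hx⟩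
  have h4 := sum_pairDistances_le (b := b) hs hp hc W
  have h5 := card_branchingPrefixes_lt (infix_right p b s)
  rw [← hTdef] at h4 h5
  rw [← hTdef'] at h4
  have h6 := sum_pred_add_card hT
  have h7 := sum_card_rightLetters_le_size T
  have h8 := Finset.sum_le_sum hterm
  simp only [Finset.sum_add_distrib] at h8
  omega

end Edit

theorem gsize_le_of_append {d : α} {p b c s : List α} (hc : c.length ≤ 1) (hs : s ≠ [])
    (hT : EndsUniquely d (p ++ b ++ s)) (hT' : EndsUniquely d (p ++ c ++ s)) :
    gsize (p ++ c ++ s) ≤ 4 * size (p ++ b ++ s) + 4 := by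
  -- As `s` is nonempty, the end-marker lies in `s` alone, behind the edit.
  have hp : d ∉ p := fun h => hs
    (List.append_eq_nil_iff.1 (hT.eq_nil_of_append (List.append_assoc p b s) h)).2
  have hse : EndsUniquely d s := by
    obtain ⟨u, hu, h⟩ := hT
    rcases List.eq_nil_or_concat' s with rfl | ⟨t, e, rfl⟩
    · exact absurd rfl hs
    rw [← List.append_assoc] at h
    obtain ⟨rfl, h2⟩ := List.append_inj' h rfl
    exact ⟨t, fun ht => hu (by simp [ht]), by rw [h2]⟩
  have h1 := gsize_le hT'
  have h2 := sum_rightLetters_pred_le (b := b) hse hp hc hT hT'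
  omega

theorem gsize_le_of_singleEdit {d : α} {T T' : List α} (hT : EndsUniquely d T)
    (hT' : EndsUniquely d T') (h : SingleEdit T T') : gsize T' ≤ 4 * size T + 4 := by
  cases h with
  | insertion p s a =>
    have hs : s ≠ [] := by
      rintro rfl
      simp only [List.append_nil] at hT
      simpa using hT'.eq_nil_of_append rfl hT.mem
    simpa using gsize_le_of_append (d := d) (p := p) (b := []) (c := [a]) (s := s) (by simp) hs
      (by simpa using hT) (by simpa using hT')
  | deletion p s a =>
    have hs : s ≠ [] := by
      rintro rfl
      simp only [List.append_nil] at hT'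
      simpa using hT.eq_nil_of_append rfl hT'.mem
    simpa using gsize_le_of_append (d := d) (p := p) (b := [a]) (c := []) (s := s) (by simp) hs
      (by simpa using hT) (by simpa using hT')
  | substitution p s a b hab =>
    have hs : s ≠ [] := by
      rintro rfl
      obtain ⟨u, -, hu⟩ := hT
      obtain ⟨v, -, hv⟩ := hT'
      have h1 := List.append_inj_right' hu rfl
      have h2 := List.append_inj_right' hv rfl
      exact hab (List.cons.inj (h1.trans h2.symm)).1
    simpa using gsize_le_of_append (d := d) (p := p) (b := [a]) (c := [b]) (s := s) (by simp) hs
      (by simpa using hT) (by simpa using hT')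

end CDAWG

theorem mainTheorem1 {α : Type*} (d : α) (T T' : List α)
    (hT : CDAWG.EndsUniquely d T) (hT' : CDAWG.EndsUniquely d T')
    (hedit : CDAWG.SingleEdit T T') :
    (CDAWG.gsize T' : ℤ) - (CDAWG.gsize T : ℤ) ≤ 4 * (CDAWG.size T : ℤ) + 4 := by
  have := CDAWG.gsize_le_of_singleEdit hT hT' hedit
  omega
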